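/- Depth-first search (DFS) of a directed multigraph on the vertices $1,\dots,n$ (loops and multiple arcs allowed, the arcs out of each vertex taken in a given order) explores the arcs out of the current vertex one by one; when an arc leads to a vertex not seen before, it explores that vertex in the same way, recursively, before it returns to the next arc. When a tree is completed, a new one is started at the unseen vertex with the smallest label, until all vertices are seen. An explored arc from $u$ to $v$ is a *loop* if $u=v$; a *tree arc* if $v$ has not been seen before; a *back arc* if $v$ is a proper ancestor of $u$ in the current forest of tree arcs; a *forward arc* if $v$ is an already seen proper descendant of $u$; and a *cross arc* otherwise. Let $L,F,B,C,T$ be the numbers of loops, forward, back, cross and tree arcs. An instance of DFS on $n$ vertices is the sequence of arcs that are explored, in the order of exploration, and $F_n(w,x,y,z,t)$ is the formal power series given by the sum of $w^Lx^Fy^Bz^Ct^T$ over all instances on $n$ vertices. Knuth's conjecture is the following assertion: for every $n\ge 1$ and every $p\in(0,1)$, if the outdegrees of the $n$ vertices are independent with $\mathbb P(\eta_i=k)=p^k(1-p)$, $k=0,1,2,\dots$, and the endpoints of all arcs are independent and uniform on the $n$ vertices, then the random variables $F$ and $B$ have the same distribution. Let the rational functions $\widehat G^X_n(w,x,z)$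 and $\widehat G^Y_n(w,x,z)$, $n\ge1$, be defined by $$\widehat G^X_1(w,x,z):=\widehat G^Y_1(w,x,z):=\frac1{1-w}$$ and, for $n\ge2$, $$\widehat G^X_n(w,x,z):=\frac{1}{1-w-(n-1)x}\sum_{m=1}^{n-1}\widehat G^X_m(w,x,z)\,\widehat G^X_{n-m}(w+mz,x,z),$$ $$\widehat G^Y_n(w,x,z):=\frac{1}{1-w-(n-1)z}\sum_{m=1}^{n-1}\widehat G^Y_m(w,x,z)\,\widehat G^Y_{n-m}(w+x+(m-1)z,x,z).$$ Corollary. The following are equivalent: (i) Knuth's conjecture; (ii) $F_n(w,x,w,w,w)=F_n(w,w,x,w,w)$ for every $n\ge1$, as formal power series in $w,x$; (iii) $\widehat G^X_n(w,x,w)=\widehat G^Y_n(w,x,w)$ for every $n\ge1$, as rational functions in $w,x$. -/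

import Mathlib

open MeasureTheory ProbabilityTheory

/-! ### Depth-first search in a multidigraph

A multidigraph on the vertices `Fin n` is a family `adj : Fin n → List (Fin n)`: the list `adj u`
holds the endpoints of the arcs going out from `u`, in the order in which the search meets them.
Loops and multiple arcs are allowed. -/

/-- The five types of arcs. -/
inductive ArcKind where
  | loop
  | forward
  | back
  | cross
  | tree
  deriving DecidableEq

/-- The state of a depth-first search: the vertices `seen` so far, the `stack` of vertices whose
exploration has started but is not completed (the current vertex first), the arcs out of each
vertex that are still to be explored, and the relation "there is a tree arc from `a` to `b`"
as found so far. -/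
structure DFSState (n : ℕ) where
  seen : Finset (Fin n)
  stack : List (Fin n)
  pending : Fin n → List (Fin n)
  treeArc : Fin n → Fin n → Prop

namespace DFSState

variable {n : ℕ}

/-- `s.Ancestor a b`: the vertex `a` is a proper ancestor of `b` in the current forest. -/
def Ancestor (s : DFSState n) (a b : Fin n) : Prop :=
  Relation.TransGen s.treeArc a b

open Classical in
/-- The type of an arc from `u` to `v` that is explored in the state `s`. -/
noncomputable def kind (s : DFSState n) (u v : Fin n) : ArcKind :=
  if v = u then .loop
  else if v ∉ s.seen then .tree
  else if s.Ancestor v u then .back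
  else if s.Ancestor u v then .forward
  else .cross

/-- Start a new tree with root `r`. -/
def startTree (s : DFSState n) (r : Fin n) : DFSState n :=
  { s with seen := insert r s.seen, stack := [r] }

/-- Leave the current vertex; `rest` is the remaining stack. -/
def leave (s : DFSState n) (rest : List (Fin n)) : DFSState n :=
  { s with stack := rest }

/-- Explore an arc from the current vertex `u` to `v`, where `vs` are the arcs out of `u` that
then remain. If `v` has not been seen before, the arc becomes a tree arc and `v` the current
vertex. -/
def explore (s : DFSState n) (u v : Fin n) (vs : List (Fin n)) : DFSState n :=
  if v ∈ s.seen then { s with pending := Function.update s.pending u vs }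
  else
    { seen := insert v s.seen
      stack := v :: s.stack
      pending := Function.update s.pending u vs
      treeArc := fun a b => s.treeArc a b ∨ (a = u ∧ b = v) }

/-- A quantity that decreases in every step of the search. -/
def weight (s : DFSState n) : ℕ :=
  2 * (Finset.univ \ s.seen).card + s.stack.length + ∑ u, (s.pending u).length

theorem card_unseen_insert (S : Finset (Fin n)) {v : Fin n} (hv : v ∉ S) :
    (Finset.univ \ insert v S).card + 1 = (Finset.univ \ S).card := by
  rw [Finset.sdiff_insert]
  exact Finset.card_erase_add_one (by simp [hv])

theorem pending_update (f : Fin n → List (Fin n)) {u v : Fin n} {vs : List (Fin n)}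
    (h : f u = v :: vs) :
    (∑ a, (Function.update f u vs a).length) + 1 = ∑ a, (f a).length := by
  rw [← Finset.add_sum_erase _ (fun a => (f a).length) (Finset.mem_univ u),
    ← Finset.add_sum_erase _ (fun a => (Function.update f u vs a).length) (Finset.mem_univ u)]
  have hs : ∑ a ∈ Finset.univ.erase u, (Function.update f u vs a).length
      = ∑ a ∈ Finset.univ.erase u, (f a).length := by
    refine Finset.sum_congr rfl fun a ha => ?_
    rw [Function.update_of_ne (Finset.ne_of_mem_erase ha)]
  simp only [Function.update_self, h, List.length_cons] at hs ⊢
  omega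

theorem weight_startTree (s : DFSState n) {r : Fin n} (hs : s.stack = []) (hr : r ∉ s.seen) :
    (s.startTree r).weight < s.weight := by
  have := card_unseen_insert s.seen hr
  simp only [weight, startTree, hs, List.length_cons, List.length_nil]
  omega

theorem weight_leave (s : DFSState n) {u : Fin n} {rest : List (Fin n)}
    (hs : s.stack = u :: rest) : (s.leave rest).weight < s.weight := by
  simp only [weight, leave, hs, List.length_cons]
  omega

theorem weight_explore (s : DFSState n) {u v : Fin n} {vs : List (Fin n)}
    (hp : s.pending u = v :: vs) : (s.explore u v vs).weight < s.weight := by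
  have h := pending_update s.pending hp
  unfold explore
  split_ifs with hv
  · simp only [weight]
    omega
  · have := card_unseen_insert s.seen hv
    simp only [weight, List.length_cons]
    omega

/-- The sequence of arcs, with their types, that the search explores from the state `s` on.
When no vertex is being explored, the search starts a new tree at the unseen vertex with the
smallest label, or stops if there is none. -/
noncomputable def run (s : DFSState n) : List (Fin n × Fin n × ArcKind) :=
  match hs : s.stack with
  | [] =>
    if h : (Finset.univ \ s.seen).Nonempty then
      run (s.startTree ((Finset.univ \ s.seen).min' h))
    else []
  | u :: rest =>
    match hp : s.pending u with
    | [] => run (s.leave rest)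
    | v :: vs => (u, v, s.kind u v) :: run (s.explore u v vs)
termination_by s.weight
decreasing_by
  · exact s.weight_startTree hs (Finset.mem_sdiff.1 (Finset.min'_mem _ h)).2
  · exact s.weight_leave hs
  · exact s.weight_explore hp

end DFSState

/-- The sequence of arcs explored by depth-first search in the multidigraph `adj`, each recorded
as (tail, head, type). -/
noncomputable def dfsArcs {n : ℕ} (adj : Fin n → List (Fin n)) :
    List (Fin n × Fin n × ArcKind) :=
  DFSState.run { seen := ∅, stack := [], pending := adj, treeArc := fun _ _ => False }

/-- The number of arcs of type `k` in a sequence of explored arcs. -/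
def countKind {n : ℕ} (k : ArcKind) (l : List (Fin n × Fin n × ArcKind)) : ℕ :=
  l.countP fun a => decide (a.2.2 = k)

/-! ### The random multidigraph and the conjecture -/

instance instMeasurableSpaceOutList (n : ℕ) : MeasurableSpace (List (Fin n)) := ⊤

/-- The law of the list of endpoints of the arcs out of one vertex: the length `k` has
probability `p ^ k * (1 - p)`, and given `k` the endpoints are independent and uniform. -/
noncomputable def outLaw (n : ℕ) [NeZero n] (p : unitInterval) : PMF (List (Fin n)) :=
  (geometricMeasure (unitInterval.symm p)).toPMF.bind fun k =>
    (PMF.uniformOfFintype (Fin k → Fin n)).map List.ofFn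

/-- The law of the random multidigraph: the lists of different vertices are independent. -/
noncomputable def digraphLaw (n : ℕ) [NeZero n] (p : unitInterval) :
    Measure (Fin n → List (Fin n)) :=
  Measure.pi fun _ => (outLaw n p).toMeasure

/-- Knuth's conjecture: for all `n ≥ 1` and `0 < p < 1`, the numbers of forward arcs and of back
arcs in the search of the random multidigraph have the same distribution. -/
def KnuthConjecture : Prop :=
  ∀ (n : ℕ) [NeZero n] (p : unitInterval), 0 < p → p < 1 →
    IdentDistrib (fun adj : Fin n → List (Fin n) => countKind .forward (dfsArcs adj))
      (fun adj : Fin n → List (Fin n) => countKind .back (dfsArcs adj))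
      (digraphLaw n p) (digraphLaw n p)

/-! ### Generating functions -/

/-- The instances of depth-first search on `n` vertices: an instance is the sequence of arcs that
are explored, in the order of exploration. -/
def dfsInstances (n : ℕ) : Set (List (Fin n × Fin n × ArcKind)) :=
  Set.range dfsArcs

/-- `F_n(w, x, y, z, t)`: the sum of `w ^ L * x ^ F * y ^ B * z ^ C * t ^ T` over all instances on
`n` vertices, as a formal power series in `w, x, y, z, t` (numbered `0, 1, 2, 3, 4`). -/
noncomputable def dfsGF (n : ℕ) : MvPowerSeries (Fin 5) ℚ := fun e =>
  ({l ∈ dfsInstances n | countKind .loop l = e 0 ∧ countKind .forward l = e 1 ∧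
    countKind .back l = e 2 ∧ countKind .cross l = e 3 ∧ countKind .tree l = e 4}.ncard : ℚ)

/-- `Ĝ^X_n(w, x, z)`, evaluated at elements of a field (the value at `n = 0` is not used). -/
def GX {K : Type*} [Field K] (n : ℕ) (w x z : K) : K :=
  match n with
  | 0 => 0
  | 1 => 1 / (1 - w)
  | n + 2 => 1 / (1 - w - (n + 1 : ℕ) * x) *
      ∑ m ∈ (Finset.Icc 1 (n + 1)).attach,
        GX m.1 w x z * GX (n + 2 - m.1) (w + (m.1 : K) * z) x z
termination_by n
decreasing_by
  all_goals
    have := Finset.mem_Icc.1 m.2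
    omega

/-- `Ĝ^Y_n(w, x, z)`, evaluated at elements of a field (the value at `n = 0` is not used). -/
def GY {K : Type*} [Field K] (n : ℕ) (w x z : K) : K :=
  match n with
  | 0 => 0
  | 1 => 1 / (1 - w)
  | n + 2 => 1 / (1 - w - (n + 1 : ℕ) * z) *
      ∑ m ∈ (Finset.Icc 1 (n + 1)).attach,
        GY m.1 w x z * GY (n + 2 - m.1) (w + x + ((m.1 : K) - 1) * z) x z
termination_by n
decreasing_by
  all_goals
    have := Finset.mem_Icc.1 m.2
    omega

/-- The field of rational functions in two indeterminates over `ℚ`. -/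
abbrev RatFunc2 : Type := FractionRing (MvPolynomial (Fin 2) ℚ)

/-- The indeterminates `w = ratVar 0` and `x = ratVar 1` as rational functions. -/
noncomputable def ratVar (i : Fin 2) : RatFunc2 :=
  algebraMap (MvPolynomial (Fin 2) ℚ) RatFunc2 (MvPolynomial.X i)

/-- The indeterminates `w = serVar 0` and `x = serVar 1` as formal power series. -/
noncomputable def serVar (i : Fin 2) : MvPowerSeries (Fin 2) ℚ := MvPowerSeries.X i

/-!
All three assertions are shown to be equivalent to a statement about finite numbers: for every
`n ≥ 1`, `a` and `k`, as many multidigraphs on `n` vertices with `a` arcs have `k` forward arcs as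
have `k` back arcs (`EqualCounts n`).

A search explores every arc, so the multidigraph can be read off from the sequence of explored arcs
(`dfsArcs_injective`), and instances of the search are the same as multidigraphs. This turns the
identity of power series into `EqualCounts n` coefficient by coefficient (`subst_dfsGF_eq_iff`).
A multidigraph with `a` arcs has probability `(1 - p) ^ n * (p / n) ^ a` (`digraphLaw_singleton`),
so `EqualCounts n` gives Knuth's conjecture for `n`. Conversely, the conjecture identifies the
generating functions `∑ w ^ #arcs * r ^ F` and `∑ w ^ #arcs * r ^ B` over all multidigraphs
(`markedGF`) for small `w`, and a single transcendental `r` suffices to recover the counts from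
them (`equalCounts_of_frequently`).

For the rational functions, the arcs are revealed only when the search meets them. The total weight
of all continuations of a search satisfies a one-step recursion (`DFSState.Tracks.restSum_step`);
it depends on the state only through the number of unseen vertices and a list of numbers, one for
each vertex on the stack (`DFSState.Tracks.restSum_eq`). Exploring one vertex is a triangular linear
system, whose solution is expressed by the generating functions `treeGF` of single trees
(`stackGF_push`); the triangular duality behind it converts the splitting by the first child, which
the search performs, into the splitting by the last child in the recursions of `Ĝ^X` and `Ĝ^Y`,
which are the specializations `y = z` and `x = z` of `treeGF`. In this way `markedGF` becomes a sum over
the trees of the forest (`stackGF_nil_succ`) that involves `Ĝ^X` and `Ĝ^Y` at the first argument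
`w + N * w`, where `N` is the number of vertices in the earlier trees. Since `Ĝ^X_n` and `Ĝ^Y_n` are
homogeneous of degree `-(2 * n - 1)` in `1, w, x, z` (`treeGF_scale`), an identity at the first
argument `w` implies the shifted ones (`TreeEq.shift`). So the identities for the trees give those
for the forests, and conversely by induction on `n`, as the largest tree occurs in the sum with
coefficient `1`. Rational functions are handled by embedding `ℚ(w, x)` into `ℝ` through
algebraically independent values of `w` and `x` (`treeEq_iff`).
-/

/-! ### The arcs explored by a search -/

namespace DFSState

variable {n : ℕ}

theorem run_startTree (s : DFSState n) (hs : s.stack = []) (h : (Finset.univ \ s.seen).Nonempty) :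
    s.run = (s.startTree ((Finset.univ \ s.seen).min' h)).run := by
  rw [run]
  split
  · rw [dif_pos h]
  · simp_all

theorem run_done (s : DFSState n) (hs : s.stack = []) (h : ¬ (Finset.univ \ s.seen).Nonempty) :
    s.run = [] := by
  rw [run]
  split
  · rw [dif_neg h]
  · simp_all

theorem run_leave (s : DFSState n) {u : Fin n} {rest : List (Fin n)} (hs : s.stack = u :: rest)
    (hp : s.pending u = []) : s.run = (s.leave rest).run := by
  rw [run]
  split
  · simp_all
  · rename_i h
    obtain ⟨rfl, rfl⟩ := List.cons.inj (hs.symm.trans h)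
    split
    · rfl
    · simp_all

theorem run_explore (s : DFSState n) {u v : Fin n} {rest vs : List (Fin n)}
    (hs : s.stack = u :: rest) (hp : s.pending u = v :: vs) :
    s.run = (u, v, s.kind u v) :: (s.explore u v vs).run := by
  rw [run]
  split
  · simp_all
  · rename_i h
    obtain ⟨rfl, rfl⟩ := List.cons.inj (hs.symm.trans h)
    split
    · simp_all
    · rename_i h'
      obtain ⟨rfl, rfl⟩ := List.cons.inj (hp.symm.trans h')
      rfl

@[simp] theorem explore_pending (s : DFSState n) (u v : Fin n) (vs : List (Fin n)) :
    (s.explore u v vs).pending = Function.update s.pending u vs := by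
  unfold explore; split_ifs <;> rfl

/-- A vertex is live if arcs out of it may still be explored: it is unseen or on the stack. -/
def Live (s : DFSState n) (u : Fin n) : Prop := u ∉ s.seen ∨ u ∈ s.stack

theorem live_explore_iff (s : DFSState n) {u v : Fin n} {rest : List (Fin n)}
    (hs : s.stack = u :: rest) (vs : List (Fin n)) (a : Fin n) :
    (s.explore u v vs).Live a ↔ s.Live a := by
  unfold explore Live
  split_ifs with hv
  · rfl
  · by_cases ha : a = v <;> simp [ha, hs, hv]

theorem live_startTree_iff (s : DFSState n) (hs : s.stack = []) (r : Fin n) (hr : r ∉ s.seen)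
    (a : Fin n) : (s.startTree r).Live a ↔ s.Live a := by
  unfold startTree Live
  by_cases ha : a = r <;> simp [ha, hs, hr]

theorem live_leave_iff (s : DFSState n) {u : Fin n} {rest : List (Fin n)}
    (hs : s.stack = u :: rest) {a : Fin n} (ha : a ≠ u) :
    (s.leave rest).Live a ↔ s.Live a := by
  simp [leave, Live, hs, ha]

theorem min'_unseen (s : DFSState n) (h : (Finset.univ \ s.seen).Nonempty) :
    (Finset.univ \ s.seen).min' h ∉ s.seen :=
  (Finset.mem_sdiff.1 (Finset.min'_mem _ h)).2

/-- Every pending arc is explored: if only live vertices have pending arcs, the heads of the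
explored arcs out of `u` are, in order, the pending ones. -/
theorem run_heads (s : DFSState n) (h : ∀ a, ¬ s.Live a → s.pending a = []) (u : Fin n) :
    ((s.run.filter fun e => e.1 = u).map fun e => e.2.1) = s.pending u := by
  induction s using run.induct with
  | case1 s hs hne ih =>
    rw [run_startTree s hs hne]
    exact ih fun a ha => h a (by rwa [live_startTree_iff s hs _ (s.min'_unseen hne)] at ha)
  | case2 s hs hne =>
    rw [run_done s hs hne, h u]
    · rfl
    · simp only [Finset.sdiff_nonempty, not_not] at hne
      simp [Live, hs, hne (Finset.mem_univ u)]
  | case3 s a rest hs hp ih =>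
    rw [run_leave s hs hp]
    refine ih fun b hb => ?_
    by_cases hba : b = a
    · rw [hba]; exact hp
    · exact h b (by rwa [live_leave_iff s hs hba] at hb)
  | case4 s a rest hs v vs hp ih =>
    have ih := ih fun b hb => by
      rw [live_explore_iff s hs] at hb
      have hba : b ≠ a := by rintro rfl; exact hb (by simp [Live, hs])
      rw [explore_pending, Function.update_of_ne hba]
      exact h b hb
    rw [explore_pending] at ih
    rw [run_explore s hs hp]
    by_cases hua : a = u
    · subst hua
      rw [Function.update_self] at ih
      simp [ih, hp]
    · rw [Function.update_of_ne (Ne.symm hua)] at ih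
      simp [ih, hua]

theorem run_length (s : DFSState n) (h : ∀ a, ¬ s.Live a → s.pending a = []) :
    s.run.length = ∑ u, (s.pending u).length := by
  simp_rw [← s.run_heads h, List.length_map, ← List.countP_eq_length_filter]
  induction s.run with
  | nil => simp
  | cons e l ih => simp [List.countP_cons, Finset.sum_add_distrib, ih]

end DFSState

section Arcs

variable {n : ℕ}

theorem dfsArcs_heads (adj : Fin n → List (Fin n)) (u : Fin n) :
    (((dfsArcs adj).filter fun e => e.1 = u).map fun e => e.2.1) = adj u :=
  DFSState.run_heads _ (fun a ha => absurd (Or.inl (by simp)) ha) u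

/-- A multidigraph can be read off from the sequence of arcs explored in it. -/
theorem dfsArcs_injective : Function.Injective (dfsArcs (n := n)) := fun adj adj' h => by
  funext u
  rw [← dfsArcs_heads adj, h, dfsArcs_heads]

theorem length_dfsArcs (adj : Fin n → List (Fin n)) :
    (dfsArcs adj).length = ∑ u, (adj u).length :=
  DFSState.run_length _ fun a ha => absurd (Or.inl (by simp)) ha

end Arcs

/-! ### The shape of the current forest -/

namespace DFSState

variable {n : ℕ}

/-- The number of unseen vertices. -/
def unseen (s : DFSState n) : ℕ := (Finset.univ \ s.seen).card

open Classical in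
/-- The number of descendants of `u` seen so far. -/
noncomputable def numDesc (s : DFSState n) (u : Fin n) : ℕ := {v ∈ s.seen | s.Ancestor u v}.card

/-- The properties of the states reached by a search that determine how many arcs of each type the
current vertex can send to the vertices seen so far. The list `cs` records for each vertex of the
stack the number of vertices that were still unseen when it was reached; each of them is by now
a descendant or still unseen. -/
structure Tracks (s : DFSState n) (cs : List ℕ) : Prop where
  nodup : s.stack.Nodup
  seen_of_mem : ∀ u ∈ s.stack, u ∈ s.seen
  seen_of_treeArc : ∀ a b, s.treeArc a b → a ∈ s.seen ∧ b ∈ s.seen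
  ancestor_iff : ∀ u rest, (u :: rest) <:+ s.stack → ∀ v, s.Ancestor v u ↔ v ∈ rest
  numDesc_add : List.Forall₂ (fun u c => s.numDesc u + s.unseen = c) s.stack cs

theorem Tracks.seen_of_ancestor {s : DFSState n} {cs : List ℕ} (h : s.Tracks cs) {a b : Fin n}
    (hab : s.Ancestor a b) : a ∈ s.seen ∧ b ∈ s.seen := by
  induction hab with
  | single h1 => exact h.seen_of_treeArc _ _ h1
  | tail _ h2 ih => exact ⟨ih.1, (h.seen_of_treeArc _ _ h2).2⟩

theorem Tracks.leave {s : DFSState n} {u : Fin n} {rest : List (Fin n)} {c : ℕ} {cs : List ℕ}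
    (h : s.Tracks (c :: cs)) (hs : s.stack = u :: rest) : (s.leave rest).Tracks cs where
  nodup := (List.nodup_cons.1 (hs ▸ h.nodup)).2
  seen_of_mem a ha := h.seen_of_mem a (by rw [hs]; exact List.mem_cons_of_mem _ ha)
  seen_of_treeArc := h.seen_of_treeArc
  ancestor_iff a l hl :=
    h.ancestor_iff a l (by rw [hs]; exact hl.trans (List.suffix_cons _ _))
  numDesc_add := by
    have := h.numDesc_add
    rw [hs] at this
    exact (List.forall₂_cons.1 this).2

theorem unseen_startTree (s : DFSState n) {r : Fin n} (hr : r ∉ s.seen) :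
    (s.startTree r).unseen + 1 = s.unseen :=
  card_unseen_insert s.seen hr

theorem Tracks.startTree {s : DFSState n} (h : s.Tracks []) {r : Fin n}
    (hr : r ∉ s.seen) : (s.startTree r).Tracks [(s.startTree r).unseen] where
  nodup := List.nodup_singleton r
  seen_of_mem a ha := by
    rw [List.mem_singleton.1 ha]
    exact Finset.mem_insert_self _ _
  seen_of_treeArc a b hab :=
    (h.seen_of_treeArc a b hab).imp Finset.mem_insert_of_mem Finset.mem_insert_of_mem
  ancestor_iff a l hl v := by
    obtain ⟨rfl, rfl⟩ : a = r ∧ l = [] := by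
      have := hl.sublist.length_le
      have h2 := hl.subset (List.mem_cons_self)
      simp only [DFSState.startTree, List.mem_singleton] at h2
      simpa [DFSState.startTree, h2] using this
    simp only [List.not_mem_nil, iff_false]
    exact fun hv => hr (h.seen_of_ancestor hv).2
  numDesc_add := by
    refine List.Forall₂.cons ?_ List.Forall₂.nil
    have : (s.startTree r).numDesc r = 0 := by
      classical
      refine Finset.card_eq_zero.2 (Finset.filter_eq_empty_iff.2 fun v _ hv => ?_)
      exact hr (h.seen_of_ancestor hv).1
    omega

theorem explore_of_seen (s : DFSState n) {u v : Fin n} (vs : List (Fin n)) (hv : v ∈ s.seen) :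
    s.explore u v vs = { s with pending := Function.update s.pending u vs } := by
  rw [explore, if_pos hv]

theorem explore_of_unseen (s : DFSState n) {u v : Fin n} (vs : List (Fin n)) (hv : v ∉ s.seen) :
    s.explore u v vs =
      { seen := insert v s.seen
        stack := v :: s.stack
        pending := Function.update s.pending u vs
        treeArc := fun a b => s.treeArc a b ∨ (a = u ∧ b = v) } := by
  rw [explore, if_neg hv]

theorem unseen_explore (s : DFSState n) {u v : Fin n} (vs : List (Fin n)) (hv : v ∉ s.seen) :
    (s.explore u v vs).unseen + 1 = s.unseen := by
  rw [explore_of_unseen s vs hv]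
  exact card_unseen_insert s.seen hv

/-- After a tree arc from `u` to `v`, the only new pairs are those of `v` with `u` and the ancestors
of `u`. -/
theorem Tracks.ancestor_explore {s : DFSState n} {cs : List ℕ} (h : s.Tracks cs) {u v : Fin n}
    (hu : u ∈ s.seen) (hv : v ∉ s.seen) (vs : List (Fin n)) (a b : Fin n) :
    (s.explore u v vs).Ancestor a b ↔ s.Ancestor a b ∨ (b = v ∧ (a = u ∨ s.Ancestor a u)) := by
  have huv : u ≠ v := fun h => hv (h ▸ hu)
  have harc : ∀ a b, (s.explore u v vs).treeArc a b ↔ s.treeArc a b ∨ (a = u ∧ b = v) := by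
    rw [explore_of_unseen s vs hv]; simp
  constructor
  · intro hab
    induction hab with
    | single h1 =>
      rcases (harc _ _).1 h1 with h1 | ⟨rfl, rfl⟩
      · exact Or.inl (.single h1)
      · exact Or.inr ⟨rfl, Or.inl rfl⟩
    | tail _ h2 ih =>
      rcases (harc _ _).1 h2 with h3 | ⟨rfl, rfl⟩
      · rcases ih with ih | ⟨rfl, _⟩
        · exact Or.inl (ih.tail h3)
        · exact absurd (h.seen_of_treeArc _ _ h3).1 hv
      · rcases ih with ih | ⟨rfl, _⟩
        · exact Or.inr ⟨rfl, Or.inr ih⟩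
        · exact absurd rfl huv
  · have hmono : ∀ {a b}, s.Ancestor a b → (s.explore u v vs).Ancestor a b := fun hab =>
      hab.lift id fun a b hab => (harc a b).2 (Or.inl hab)
    have huv' : (s.explore u v vs).treeArc u v := (harc u v).2 (Or.inr ⟨rfl, rfl⟩)
    rintro (hab | ⟨rfl, rfl | hau⟩)
    · exact hmono hab
    · exact .single huv'
    · exact (hmono hau).tail huv'

theorem Tracks.explore {s : DFSState n} {cs : List ℕ} (h : s.Tracks cs) {u v : Fin n}
    {rest : List (Fin n)} (hs : s.stack = u :: rest) (hv : v ∉ s.seen) (vs : List (Fin n)) :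
    (s.explore u v vs).Tracks ((s.explore u v vs).unseen :: cs) := by
  have hu : u ∈ s.seen := h.seen_of_mem u (by simp [hs])
  have hvs : v ∉ s.stack := fun hv' => hv (h.seen_of_mem v hv')
  have hanc := h.ancestor_explore hu hv vs
  have hun := s.unseen_explore (u := u) vs hv
  have hseen : (s.explore u v vs).seen = insert v s.seen := by rw [explore_of_unseen s vs hv]
  have hstack : (s.explore u v vs).stack = v :: s.stack := by rw [explore_of_unseen s vs hv]
  have hcur : ∀ a, a = u ∨ s.Ancestor a u ↔ a ∈ s.stack := by
    intro a
    rw [h.ancestor_iff u rest (by rw [hs]) a, hs, List.mem_cons]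
  refine ⟨?_, ?_, ?_, ?_, ?_⟩
  · rw [hstack]; exact List.nodup_cons.2 ⟨hvs, h.nodup⟩
  · intro a ha
    rw [hstack, List.mem_cons] at ha
    rw [hseen, Finset.mem_insert]
    exact ha.imp_right (h.seen_of_mem a)
  · intro a b hab
    rw [hseen]
    rw [explore_of_unseen s vs hv] at hab
    rcases hab with hab | ⟨rfl, rfl⟩
    · exact (h.seen_of_treeArc a b hab).imp Finset.mem_insert_of_mem Finset.mem_insert_of_mem
    · exact ⟨Finset.mem_insert_of_mem hu, Finset.mem_insert_self _ _⟩
  · intro a l hl b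
    rw [hstack, List.suffix_cons_iff] at hl
    rw [hanc, hcur]
    rcases hl with hl | hl
    · obtain ⟨rfl, rfl⟩ := List.cons.inj hl
      have : ¬ s.Ancestor b a := fun hb => hv (h.seen_of_ancestor hb).2
      simp [this]
    · have hav : a ≠ v := by
        rintro rfl
        exact hvs (hl.subset List.mem_cons_self)
      simp [hav, h.ancestor_iff a l hl b]
  · rw [hstack]
    refine List.Forall₂.cons ?_ ?_
    · have : (s.explore u v vs).numDesc v = 0 := by
        classical
        refine Finset.card_eq_zero.2 (Finset.filter_eq_empty_iff.2 fun a _ ha => ?_)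
        rw [hanc, hcur] at ha
        rcases ha with ha | ⟨_, ha⟩
        · exact hv (h.seen_of_ancestor ha).1
        · exact hvs ha
      omega
    · refine (List.forall₂_iff_get.2 ⟨h.numDesc_add.length_eq, fun i h1 h2 => ?_⟩)
      rw [← (List.forall₂_iff_get.1 h.numDesc_add).2 i h1 h2]
      have hmem : s.stack.get ⟨i, h1⟩ ∈ s.stack := List.get_mem _ _
      generalize s.stack.get ⟨i, h1⟩ = a at hmem
      have hva : ¬ s.Ancestor a v := fun ha => hv (h.seen_of_ancestor ha).2
      have : (s.explore u v vs).numDesc a = s.numDesc a + 1 := by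
        classical
        unfold numDesc
        have hins : (Finset.filter (fun b => (s.explore u v vs).Ancestor a b)
            (s.explore u v vs).seen) =
              insert v (Finset.filter (fun b => s.Ancestor a b) s.seen) := by
          ext b
          by_cases hbv : b = v
          · subst hbv
            simp [hseen, hanc, hcur, hmem]
          · simp [hseen, hanc, hbv]
        rw [hins, Finset.card_insert_of_notMem (by simp [hv])]
      omega

theorem kind_of_unseen {s : DFSState n} {u v : Fin n} (hu : u ∈ s.seen) (hv : v ∉ s.seen) :
    s.kind u v = .tree := by
  rw [kind, if_neg (by rintro rfl; exact hv hu), if_pos hv]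

/-- The total weight of the arcs from the current vertex to the vertices seen so far, each taken
once. -/
theorem Tracks.sum_kind_seen {s : DFSState n} {u : Fin n} {rest : List (Fin n)} {c : ℕ}
    {cs : List ℕ} (h : s.Tracks (c :: cs)) (hs : s.stack = u :: rest) (W : ArcKind → ℝ) :
    ∑ v ∈ s.seen, W (s.kind u v) =
      W .loop + W .forward * ((c : ℝ) - s.unseen) + W .back * (cs.length : ℝ) +
        W .cross * ((n : ℝ) - 1 - c - cs.length) := by
  classical
  have hu : u ∈ s.seen := h.seen_of_mem u (by simp [hs])
  have hanc := h.ancestor_iff u rest (by rw [hs])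
  have hnodup := List.nodup_cons.1 (hs ▸ h.nodup)
  have huu : ¬ s.Ancestor u u := by rw [hanc]; exact hnodup.1
  have hfall := h.numDesc_add
  rw [hs] at hfall
  obtain ⟨hc, hrest⟩ := List.forall₂_cons.1 hfall
  have key : ∀ v ∈ s.seen, W (s.kind u v) = W .cross + (if v = u then W .loop - W .cross else 0) +
      (if s.Ancestor v u then W .back - W .cross else 0) +
      (if s.Ancestor u v then W .forward - W .cross else 0) := by
    intro v hv
    by_cases hvu : v = u
    · subst hvu; simp [kind, huu]
    · by_cases h1 : s.Ancestor v u
      · have h2 : ¬ s.Ancestor u v := fun h2 => huu (h2.trans h1)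
        simp [kind, hvu, hv, h1, h2]
      · by_cases h2 : s.Ancestor u v <;> simp [kind, hvu, hv, h1, h2]
  have hback : (s.seen.filter fun v => s.Ancestor v u) = rest.toFinset := by
    ext v
    simp only [Finset.mem_filter, List.mem_toFinset, hanc, and_iff_right_iff_imp]
    exact fun hv => h.seen_of_mem v (by rw [hs]; exact List.mem_cons_of_mem _ hv)
  have hcard : ((Finset.univ \ s.seen).card : ℝ) + s.seen.card = n := by
    have := Finset.card_sdiff_add_card_eq_card (Finset.subset_univ s.seen)
    rw [Finset.card_univ, Fintype.card_fin] at this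
    exact_mod_cast this
  rw [Finset.sum_congr rfl key]
  simp only [Finset.sum_add_distrib, Finset.sum_const, Finset.sum_ite_eq', hu, if_true,
    nsmul_eq_mul, ← Finset.sum_filter, hback, List.toFinset_card_of_nodup hnodup.2,
    hrest.length_eq]
  have hc' : (s.numDesc u : ℝ) + s.unseen = c := by exact_mod_cast hc
  unfold numDesc unseen at hc'
  unfold unseen
  linear_combination (W .forward - W .cross) * hc' + W .cross * hcard

end DFSState

/-! ### Summation over the arcs that are still to be explored -/

section Sums

open ENNReal

/-- Splitting a sum over families of lists according to the first entry of the list at `u`. -/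
theorem tsum_split_head {ι α : Type*} [DecidableEq ι] [Fintype α]
    (f : (ι → List α) → ℝ≥0∞) (u : ι) :
    ∑' P, f P = ∑' P, (if P u = [] then f P else 0) +
      ∑ v, ∑' P : ι → List α, f (Function.update P u (v :: P u)) := by
  have h1 : ∀ P, f P = (if P u = [] then f P else 0) + (if P u = [] then 0 else f P) := by
    intro P; split_ifs <;> simp
  rw [tsum_congr h1, ENNReal.tsum_add]
  congr 1
  have hinj : Function.Injective
      fun q : α × (ι → List α) => Function.update q.2 u (q.1 :: q.2 u) := by
    rintro ⟨v, P⟩ ⟨v', P'⟩ h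
    have hu := congrFun h u
    simp only [Function.update_self, List.cons.injEq] at hu
    refine Prod.ext hu.1 (funext fun a => ?_)
    by_cases ha : a = u
    · rw [ha]; exact hu.2
    · simpa [Function.update_of_ne ha] using congrFun h a
  rw [← hinj.tsum_eq, ← tsum_fintype (L := .unconditional _), ← ENNReal.tsum_prod]
  · simp
  · intro P hP
    rcases hPu : P u with _ | ⟨v, vs⟩
    · simp [hPu] at hP
    · exact ⟨(v, Function.update P u vs), by simp [← hPu]⟩

/-- The product of the weights of a sequence of arcs, an arc of type `k` having weight `W k`. -/
noncomputable def arcsWeight {n : ℕ} (W : ArcKind → ℝ≥0∞) (l : List (Fin n × Fin n × ArcKind)) :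
    ℝ≥0∞ :=
  (l.map fun e => W e.2.2).prod

theorem arcsWeight_le {n : ℕ} {W : ArcKind → ℝ≥0∞} {q : ℝ≥0∞} (hW : ∀ k, W k ≤ q)
    (l : List (Fin n × Fin n × ArcKind)) : arcsWeight W l ≤ q ^ l.length := by
  unfold arcsWeight
  induction l with
  | nil => simp
  | cons e l ih =>
    rw [List.map_cons, List.prod_cons, List.length_cons, pow_succ']
    exact mul_le_mul' (hW _) ih

namespace DFSState

variable {n : ℕ}

open Classical in
/-- The total weight of all continuations of a search from the state `s`. The arcs still pending
in `s` are disregarded; instead, all possibilities for the arcs out of the live vertices are summed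
over. -/
noncomputable def restSum (W : ArcKind → ℝ≥0∞) (s : DFSState n) : ℝ≥0∞ :=
  ∑' P : Fin n → List (Fin n),
    if ∀ a, ¬ s.Live a → P a = [] then arcsWeight W (run { s with pending := P }) else 0

theorem restSum_le (W : ArcKind → ℝ≥0∞) {q : ℝ≥0∞} (hW : ∀ k, W k ≤ q) (s : DFSState n) :
    s.restSum W ≤ ∑' P : Fin n → List (Fin n), q ^ ∑ u, (P u).length := by
  refine ENNReal.tsum_le_tsum fun P => ?_
  split_ifs with h
  · refine (arcsWeight_le hW _).trans_eq ?_
    rw [run_length _ h]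
  · exact zero_le

theorem restSum_with_pending (W : ArcKind → ℝ≥0∞) (s : DFSState n) (Q : Fin n → List (Fin n)) :
    restSum W { s with pending := Q } = s.restSum W := rfl

theorem restSum_done (W : ArcKind → ℝ≥0∞) (s : DFSState n) (hs : s.stack = [])
    (h : s.unseen = 0) : s.restSum W = 1 := by
  have h' : Finset.univ \ s.seen = ∅ := Finset.card_eq_zero.1 h
  have hlive : ∀ a, ¬ s.Live a := fun a => by
    simpa [Live, hs] using Finset.sdiff_eq_empty_iff_subset.1 h' (Finset.mem_univ a)
  unfold restSum
  rw [tsum_eq_single (fun _ => [])]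
  · rw [if_pos fun _ _ => rfl, run_done { s with pending := fun _ => [] } hs (by simp [h'])]
    simp [arcsWeight]
  · intro P hP
    rw [if_neg]
    exact fun hall => hP (funext fun a => hall a (hlive a))

theorem restSum_startTree (W : ArcKind → ℝ≥0∞) (s : DFSState n) (hs : s.stack = [])
    (h : (Finset.univ \ s.seen).Nonempty) :
    s.restSum W = (s.startTree ((Finset.univ \ s.seen).min' h)).restSum W := by
  unfold restSum
  refine tsum_congr fun P => ?_
  classical
  refine if_congr (forall_congr' fun a => ?_) ?_ rfl
  · rw [live_startTree_iff s hs _ (s.min'_unseen h)]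
  · rw [run_startTree { s with pending := P } hs h]
    rfl

theorem restSum_explore (W : ArcKind → ℝ≥0∞) (s : DFSState n) {u : Fin n} {rest : List (Fin n)}
    (hs : s.stack = u :: rest) (hu : u ∈ s.seen) (hrest : u ∉ rest) :
    s.restSum W = (s.leave rest).restSum W +
      ∑ v, W (s.kind u v) * (s.explore u v []).restSum W := by
  classical
  have hlive : s.Live u := by simp [Live, hs]
  unfold restSum
  rw [tsum_split_head _ u]
  congr 1
  · refine tsum_congr fun P => ?_
    by_cases hP : P u = []
    · rw [if_pos hP, run_leave { s with pending := P } hs hP]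
      have : (∀ a, ¬ s.Live a → P a = []) ↔ ∀ a, ¬ (s.leave rest).Live a → P a = [] := by
        refine forall_congr' fun a => ?_
        by_cases ha : a = u
        · subst ha; simp [hP]
        · rw [live_leave_iff s hs ha]
      exact if_congr this rfl rfl
    · rw [if_neg hP, if_neg]
      exact fun h => hP (h u (by simp [Live, leave, hu, hrest]))
  · refine Finset.sum_congr rfl fun v _ => ?_
    rw [← ENNReal.tsum_mul_left]
    refine tsum_congr fun P => ?_
    have : (∀ a, ¬ s.Live a → Function.update P u (v :: P u) a = []) ↔
        ∀ a, ¬ (s.explore u v []).Live a → P a = [] := by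
      refine forall_congr' fun a => ?_
      rw [live_explore_iff s hs]
      by_cases ha : a = u
      · subst ha; simp [hlive]
      · rw [Function.update_of_ne ha]
    rw [mul_ite, mul_zero]
    refine if_congr this ?_ rfl
    rw [run_explore { s with pending := Function.update P u (v :: P u) } hs
      (Function.update_self ..)]
    have hst : explore { s with pending := Function.update P u (v :: P u) } u v (P u) =
        { s.explore u v [] with pending := P } := by
      unfold explore
      split_ifs <;> simp
    rw [hst]
    rfl

end DFSState

end Sums

/-! ### The generating functions of trees and forests -/

section Algebra

variable {K : Type*} [Field K]

/-- The generating function of the explorations of a tree with `j + 1` vertices from its root, in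
which `w` is the weight of an arc that is a loop or leads to a vertex seen before the root, and the
choice of the heads of tree arcs is not counted. The recursion splits off the subtree of the last
child of the root. -/
def treeGF (x y z : K) (j : ℕ) (w : K) : K :=
  ((if j = 0 then 1 else 0) +
    ∑ i : Fin j, treeGF x y z i w * treeGF x y z (j - 1 - i) (w + y + (i : ℕ) * z)) /
      (1 - w - j * x)
termination_by j
decreasing_by
  · exact i.2
  · omega

theorem treeGF_eq (x y z : K) (j : ℕ) (w : K) :
    treeGF x y z j w = ((if j = 0 then 1 else 0) +
      ∑ i ∈ Finset.range j, treeGF x y z i w * treeGF x y z (j - 1 - i) (w + y + i * z)) /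
        (1 - w - j * x) := by
  rw [treeGF, Fin.sum_univ_eq_sum_range
    (fun i => treeGF x y z i w * treeGF x y z (j - 1 - i) (w + y + i * z))]

theorem sum_Icc_one_succ {M : Type*} [AddCommMonoid M] (f : ℕ → M) (n : ℕ) :
    ∑ m ∈ Finset.Icc 1 (n + 1), f m = ∑ i ∈ Finset.range (n + 1), f (i + 1) := by
  rw [Finset.range_eq_Ico, Finset.sum_Ico_add' f 0 (n + 1) 1]
  rfl

theorem GX_eq_treeGF (n : ℕ) (w x z : K) : GX (n + 1) w x z = treeGF x z z n w := by
  induction n using Nat.strong_induction_on generalizing w with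
  | _ n ih =>
    rcases n with _ | n
    · rw [GX, treeGF_eq]; simp
    · rw [GX, treeGF_eq,
        Finset.sum_attach _ (fun m => GX m w x z * GX (n + 2 - m) (w + (m : K) * z) x z),
        sum_Icc_one_succ, if_neg n.succ_ne_zero, zero_add, one_div, inv_mul_eq_div]
      congr 1
      refine Finset.sum_congr rfl fun i hi => ?_
      have hi := Finset.mem_range.1 hi
      rw [ih i hi, show n + 2 - (i + 1) = n - i + 1 by omega, ih (n - i) (by omega),
        Nat.add_sub_cancel]
      congr 2
      push_cast
      ring

theorem GY_eq_treeGF (n : ℕ) (w x z : K) : GY (n + 1) w x z = treeGF z x z n w := by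
  induction n using Nat.strong_induction_on generalizing w with
  | _ n ih =>
    rcases n with _ | n
    · rw [GY, treeGF_eq]; simp
    · rw [GY, treeGF_eq,
        Finset.sum_attach _
          (fun m => GY m w x z * GY (n + 2 - m) (w + x + ((m : K) - 1) * z) x z),
        sum_Icc_one_succ, if_neg n.succ_ne_zero, zero_add, one_div, inv_mul_eq_div]
      congr 1
      refine Finset.sum_congr rfl fun i hi => ?_
      have hi := Finset.mem_range.1 hi
      rw [ih i hi, show n + 2 - (i + 1) = n - i + 1 by omega, ih (n - i) (by omega),
        Nat.add_sub_cancel]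
      congr 2
      push_cast
      ring

/-- If every weight and the constant `1` are scaled by `l`, the tree generating function is divided
by `l ^ (2 * j + 1)`. -/
theorem treeGF_scale (l x y z : K) (j : ℕ) (w : K) :
    treeGF (l * x) (l * y) (l * z) j (1 - l * (1 - w)) = treeGF x y z j w / l ^ (2 * j + 1) := by
  induction j using Nat.strong_induction_on generalizing w with
  | _ j ih =>
    rw [treeGF_eq, treeGF_eq x]
    have hD : 1 - (1 - l * (1 - w)) - j * (l * x) = l * (1 - w - j * x) := by ring
    have hsum : (if j = 0 then (1 : K) else 0) + ∑ i ∈ Finset.range j,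
        treeGF (l * x) (l * y) (l * z) i (1 - l * (1 - w)) *
          treeGF (l * x) (l * y) (l * z) (j - 1 - i) (1 - l * (1 - w) + l * y + i * (l * z)) =
        ((if j = 0 then (1 : K) else 0) + ∑ i ∈ Finset.range j,
          treeGF x y z i w * treeGF x y z (j - 1 - i) (w + y + i * z)) / l ^ (2 * j) := by
      rw [add_div, Finset.sum_div]
      congr 1
      · split_ifs with h <;> simp [h]
      · refine Finset.sum_congr rfl fun i hi => ?_
        have hi := Finset.mem_range.1 hi
        have hw : 1 - l * (1 - w) + l * y + i * (l * z) = 1 - l * (1 - (w + y + i * z)) := by ring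
        rw [hw, ih i hi, ih (j - 1 - i) (by omega), div_mul_div_comm, ← pow_add]
        congr 2
        omega
    rw [hD, hsum, div_div, div_div]
    congr 1
    ring

/-- A row vector solving an upper triangular system against a column vector solving the transposed
one. -/
theorem triangular_duality (D h V φ : ℕ → K) (U : ℕ → ℕ → K) (c : ℕ)
    (hh : ∀ j ≤ c, D j * h j = (if j = 0 then 1 else 0) + ∑ i ∈ Finset.range j, h i * U i j)
    (hV : ∀ i ≤ c, D i * V i = φ i + ∑ j ∈ Finset.Ioc i c, U i j * V j) :
    V 0 = ∑ j ∈ Finset.range (c + 1), h j * φ j := by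
  have h1 : ∑ j ∈ Finset.range (c + 1), h j * φ j =
      ∑ j ∈ Finset.range (c + 1), D j * h j * V j -
        ∑ i ∈ Finset.range (c + 1), ∑ j ∈ Finset.Ioc i c, h i * U i j * V j := by
    rw [← Finset.sum_sub_distrib]
    refine Finset.sum_congr rfl fun j hj => ?_
    simp_rw [mul_assoc (h j), ← Finset.mul_sum]
    linear_combination (-h j) * hV j (by simpa [Nat.lt_succ_iff] using hj)
  have h2 : ∑ i ∈ Finset.range (c + 1), ∑ j ∈ Finset.Ioc i c, h i * U i j * V j =
      ∑ j ∈ Finset.range (c + 1), ∑ i ∈ Finset.range j, h i * U i j * V j := by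
    refine Finset.sum_comm' fun i j => ?_
    simp only [Finset.mem_range, Finset.mem_Ioc]
    omega
  rw [h1, h2, ← Finset.sum_sub_distrib, Finset.sum_eq_single 0]
  · simp [hh 0 (Nat.zero_le c)]
  · intro j hj hj0
    rw [hh j (by simpa [Nat.lt_succ_iff] using hj), if_neg hj0, zero_add, Finset.sum_mul, sub_self]
  · simp

/-- The factor by which the exploration of the current vertex is divided, if `k` vertices are
unseen, `c` vertices were unseen when the current vertex was reached, and it has `d` proper
ancestors. -/
def stepDenom (n : ℕ) (w x y z : K) (k c d : ℕ) : K :=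
  1 - w - x * ((c : K) - k) - y * d - z * ((n : K) - 1 - c - d)

/-- The total weight of the continuations of a search, up to the factor `t ^ k * k!` that accounts
for the heads of tree arcs. Here `k` is the number of unseen vertices, and the list contains, for
each vertex of the stack, the number of vertices that were unseen when it was reached. -/
def stackGF (n : ℕ) (w x y z t : K) : ℕ → List ℕ → K
  | 0, [] => 1
  | k + 1, [] => stackGF n w x y z t k [k] / (t * (k + 1))
  | 0, c :: S => stackGF n w x y z t 0 S / stepDenom n w x y z 0 c S.length
  | k + 1, c :: S =>
    (stackGF n w x y z t (k + 1) S + stackGF n w x y z t k (k :: c :: S)) /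
      stepDenom n w x y z (k + 1) c S.length
termination_by k S => (k, S.length)

/-- A vertex that has just been reached contributes the generating functions of the possible
trees below it. -/
theorem stackGF_push (n : ℕ) (w x y z t : K)
    (hD : ∀ k c d, k ≤ c → c + d + 1 ≤ n → stepDenom n w x y z k c d ≠ 0)
    (c : ℕ) (S : List ℕ) (hc : c + S.length + 1 ≤ n) :
    stackGF n w x y z t c (c :: S) = ∑ m ∈ Finset.range (c + 1),
      treeGF x y z m (w + y * S.length + z * ((n : K) - 1 - c - S.length)) *
        stackGF n w x y z t (c - m) S := by
  induction c using Nat.strong_induction_on generalizing S with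
  | _ c ih =>
    set w' : K := w + y * S.length + z * ((n : K) - 1 - c - S.length) with hw'
    have hD' : ∀ j ≤ c, stepDenom n w x y z (c - j) c S.length = 1 - w' - j * x := by
      intro j hj
      rw [stepDenom, Nat.cast_sub hj, hw']
      ring
    have hne : ∀ j ≤ c, 1 - w' - j * x ≠ 0 := fun j hj => by
      rw [← hD' j hj]
      exact hD _ _ _ (Nat.sub_le _ _) hc
    refine triangular_duality (fun j => 1 - w' - j * x) (fun j => treeGF x y z j w')
      (fun j => stackGF n w x y z t (c - j) (c :: S)) (fun j => stackGF n w x y z t (c - j) S)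
      (fun i j => treeGF x y z (j - 1 - i) (w' + y + i * z)) c (fun j hj => ?_) (fun i hi => ?_)
    · rw [treeGF_eq, mul_div_cancel₀ _ (hne j hj)]
    · rw [← hD' i hi]
      rcases hci : c - i with _ | k
      · rw [stackGF, mul_div_cancel₀ _ (by rw [← hci, hD' i hi]; exact hne i hi),
          show Finset.Ioc i c = ∅ from Finset.Ioc_eq_empty (by omega)]
        simp
      · have hik : c = i + k + 1 := by omega
        rw [stackGF, mul_div_cancel₀ _ (by rw [← hci, hD' i hi]; exact hne i hi),
          ih k (by omega) _ (by simp only [List.length_cons]; omega)]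
        congr 1
        refine Finset.sum_nbij' (fun m => i + 1 + m) (fun j => j - (i + 1)) ?_ ?_ ?_ ?_ ?_
        · intro m hm; simp only [Finset.mem_range, Finset.mem_Ioc] at *; omega
        · intro m hm; simp only [Finset.mem_range, Finset.mem_Ioc] at *; omega
        · intro m hm; simp only [Finset.mem_range] at *; omega
        · intro m hm; simp only [Finset.mem_Ioc] at *; omega
        · intro m hm
          have e1 : i + 1 + m - 1 - i = m := by omega
          have e2 : c - (i + 1 + m) = k - m := by omega
          have e3 : w + y * ((c :: S).length : K) + z * ((n : K) - 1 - k - ((c :: S).length : K))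
              = w' + y + i * z := by
            rw [hw', hik, List.length_cons]; push_cast; ring
          rw [e1, e2, e3]

/-- Splitting off the first tree of the search of the last `k + 1` vertices. -/
theorem stackGF_nil_succ (n : ℕ) (w x y z t : K)
    (hD : ∀ k c d, k ≤ c → c + d + 1 ≤ n → stepDenom n w x y z k c d ≠ 0)
    (k : ℕ) (hk : k + 1 ≤ n) :
    stackGF n w x y z t (k + 1) [] = (∑ m ∈ Finset.range (k + 1),
      treeGF x y z m (w + z * ((n : K) - 1 - k)) * stackGF n w x y z t (k - m) []) /
        (t * (k + 1)) := by
  rw [stackGF, stackGF_push n w x y z t hD k [] hk]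
  simp

end Algebra

/-! ### The total weight of the continuations of a search -/

section Continuations

open ENNReal

namespace DFSState

variable {n : ℕ}

/-- The current vertex, its ancestors, its seen descendants and the unseen vertices are distinct. -/
theorem Tracks.add_length_succ_le {s : DFSState n} {c : ℕ} {cs : List ℕ} (h : s.Tracks (c :: cs)) :
    c + cs.length + 1 ≤ n := by
  classical
  obtain ⟨u, rest, hc, hrest, hs⟩ := List.forall₂_cons_right_iff.1 h.numDesc_add
  have hanc := h.ancestor_iff u rest (by rw [hs])
  have hnodup := List.nodup_cons.1 (hs ▸ h.nodup)
  have huu : ¬ s.Ancestor u u := by rw [hanc]; exact hnodup.1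
  have hdisj : Disjoint (s.seen.filter fun v => s.Ancestor u v) s.stack.toFinset := by
    refine Finset.disjoint_left.2 fun v hv hv' => ?_
    have hv := (Finset.mem_filter.1 hv).2
    rw [List.mem_toFinset, hs, List.mem_cons, ← hanc] at hv'
    rcases hv' with rfl | hv'
    · exact huu hv
    · exact huu (hv.trans hv')
  have h1 : s.numDesc u + s.stack.length ≤ s.seen.card := by
    rw [← List.toFinset_card_of_nodup h.nodup, numDesc, ← Finset.card_union_of_disjoint hdisj]
    refine Finset.card_le_card (Finset.union_subset (Finset.filter_subset _ _) fun a ha => ?_)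
    exact h.seen_of_mem a (List.mem_toFinset.1 ha)
  have h2 := Finset.card_sdiff_add_card_eq_card (Finset.subset_univ s.seen)
  rw [Finset.card_univ, Fintype.card_fin] at h2
  have h3 := h.numDesc_add.length_eq
  rw [List.length_cons] at h3
  unfold unseen at hc
  omega

/-- The recursion for the total weight at a state with current vertex `u`: the arcs from `u` to
seen vertices do not change the state and are moved to the left-hand side. -/
theorem Tracks.restSum_step {s : DFSState n} {u : Fin n} {rest : List (Fin n)} {c : ℕ}
    {cs : List ℕ} (h : s.Tracks (c :: cs)) (hs : s.stack = u :: rest) (W : ArcKind → ℝ)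
    (hW0 : ∀ k, 0 ≤ W k)
    (hfin : ∀ s' : DFSState n, s'.restSum (fun k => ENNReal.ofReal (W k)) ≠ ∞) :
    stepDenom n (W .loop) (W .forward) (W .back) (W .cross) s.unseen c cs.length *
        (s.restSum fun k => ENNReal.ofReal (W k)).toReal =
      ((s.leave rest).restSum fun k => ENNReal.ofReal (W k)).toReal +
        ∑ v ∈ Finset.univ \ s.seen,
          W .tree * ((s.explore u v []).restSum fun k => ENNReal.ofReal (W k)).toReal := by
  have hu : u ∈ s.seen := h.seen_of_mem u (by simp [hs])
  have hstep := congrArg ENNReal.toReal (s.restSum_explore (fun k => ENNReal.ofReal (W k)) hs hu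
    (List.nodup_cons.1 (hs ▸ h.nodup)).1)
  rw [ENNReal.toReal_add (hfin _) (ENNReal.sum_ne_top.2 fun v _ =>
      ENNReal.mul_ne_top ENNReal.ofReal_ne_top (hfin _)),
    ENNReal.toReal_sum fun v _ => ENNReal.mul_ne_top ENNReal.ofReal_ne_top (hfin _)] at hstep
  simp_rw [ENNReal.toReal_mul, ENNReal.toReal_ofReal (hW0 _)] at hstep
  rw [← Finset.sum_sdiff (Finset.subset_univ s.seen)] at hstep
  have h1 : ∑ v ∈ s.seen, W (s.kind u v) *
      ((s.explore u v []).restSum fun k => ENNReal.ofReal (W k)).toReal =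
      (∑ v ∈ s.seen, W (s.kind u v)) * (s.restSum fun k => ENNReal.ofReal (W k)).toReal := by
    rw [Finset.sum_mul]
    refine Finset.sum_congr rfl fun v hv => ?_
    rw [explore_of_seen s [] hv, restSum_with_pending]
  have h2 : ∑ v ∈ Finset.univ \ s.seen, W (s.kind u v) *
      ((s.explore u v []).restSum fun k => ENNReal.ofReal (W k)).toReal =
      ∑ v ∈ Finset.univ \ s.seen,
        W .tree * ((s.explore u v []).restSum fun k => ENNReal.ofReal (W k)).toReal := by
    refine Finset.sum_congr rfl fun v hv => ?_
    rw [kind_of_unseen hu (Finset.mem_sdiff.1 hv).2]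
  rw [h1, h2, h.sum_kind_seen hs W] at hstep
  rw [stepDenom]
  linear_combination hstep

/-- The total weight of the continuations depends only on the number of unseen vertices and on the
list tracked along the stack. -/
theorem Tracks.restSum_eq {s : DFSState n} {cs : List ℕ} (h : s.Tracks cs) (W : ArcKind → ℝ)
    (hW0 : ∀ k, 0 ≤ W k) (ht : W .tree ≠ 0)
    (hfin : ∀ s' : DFSState n, s'.restSum (fun k => ENNReal.ofReal (W k)) ≠ ∞)
    (hD : ∀ k c d, k ≤ c → c + d + 1 ≤ n →
      stepDenom n (W .loop) (W .forward) (W .back) (W .cross) k c d ≠ 0) :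
    (s.restSum fun k => ENNReal.ofReal (W k)).toReal =
      W .tree ^ s.unseen * (s.unseen.factorial : ℝ) *
        stackGF n (W .loop) (W .forward) (W .back) (W .cross) (W .tree) s.unseen cs := by
  induction hN : 2 * s.unseen + s.stack.length using Nat.strong_induction_on generalizing s cs with
  | _ N ih =>
    rcases cs with _ | ⟨c, cs⟩
    · have hs : s.stack = [] := List.length_eq_zero_iff.1 h.numDesc_add.length_eq
      rcases hk : s.unseen with _ | k
      · rw [restSum_done _ s hs hk, stackGF]
        simp
      · have hne : (Finset.univ \ s.seen).Nonempty :=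
          Finset.card_pos.1 (by unfold unseen at hk; omega)
        have hr := s.min'_unseen hne
        have hun := s.unseen_startTree hr
        have hst := h.startTree hr
        have hk' : (s.startTree ((Finset.univ \ s.seen).min' hne)).unseen = k := by omega
        have hlen : (s.startTree ((Finset.univ \ s.seen).min' hne)).stack.length = 1 := rfl
        rw [restSum_startTree _ s hs hne,
          ih _ (by rw [← hN, hk', hk, hlen]; omega) hst rfl, hk', stackGF,
          Nat.factorial_succ]
        push_cast
        field_simp
        ring
    · obtain ⟨u, rest, hs⟩ : ∃ u rest, s.stack = u :: rest := by
        rcases hst : s.stack with _ | ⟨u, rest⟩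
        · have := h.numDesc_add.length_eq
          simp [hst] at this
        · exact ⟨u, rest, rfl⟩
      have hlen := h.numDesc_add.length_eq
      rw [hs, List.length_cons, List.length_cons] at hlen
      have hc : s.unseen ≤ c := by
        have := h.numDesc_add
        rw [hs] at this
        have := (List.forall₂_cons.1 this).1
        omega
      have hcd := h.add_length_succ_le
      have hD' := hD _ _ _ hc hcd
      have hstep := h.restSum_step hs W hW0 hfin
      have hleave : (s.leave rest).unseen = s.unseen := rfl
      have hleave' : (s.leave rest).stack.length = rest.length := rfl
      rw [ih _ (by rw [← hN, hleave, hleave', hs, List.length_cons]; omega) (h.leave hs) rfl,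
        hleave] at hstep
      refine mul_left_cancel₀ hD' (hstep.trans ?_)
      rcases hk : s.unseen with _ | k
      · rw [hk] at hD'
        rw [Finset.card_eq_zero.1 hk, Finset.sum_empty, stackGF]
        field_simp
        ring
      · have hsum : ∀ v ∈ Finset.univ \ s.seen,
            W .tree * ((s.explore u v []).restSum fun k => ENNReal.ofReal (W k)).toReal =
              W .tree * (W .tree ^ k * (k.factorial : ℝ) * stackGF n (W .loop) (W .forward)
                (W .back) (W .cross) (W .tree) k (k :: c :: cs)) := by
          intro v hv
          have hv := (Finset.mem_sdiff.1 hv).2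
          have hun := s.unseen_explore (u := u) [] hv
          have hk' : (s.explore u v []).unseen = k := by omega
          have hst : (s.explore u v []).stack.length = s.stack.length + 1 := by
            rw [explore_of_unseen s [] hv, List.length_cons]
          rw [ih _ (by rw [← hN, hk', hk, hst]; omega) (h.explore hs hv []) rfl, hk']
        rw [Finset.sum_congr rfl hsum, Finset.sum_const, nsmul_eq_mul,
          show (Finset.univ \ s.seen).card = k + 1 from hk, stackGF, Nat.factorial_succ]
        rw [hk] at hD'
        push_cast
        field_simp
        ring

end DFSState

end Continuations

/-! ### The random multidigraph -/

section Law

open ENNReal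

instance instDiscreteMeasurableSpaceOutList (n : ℕ) : DiscreteMeasurableSpace (List (Fin n)) :=
  ⟨fun _ => trivial⟩

variable {n : ℕ}

/-- The number of arcs of a multidigraph. -/
def numArcs (adj : Fin n → List (Fin n)) : ℕ := ∑ u, (adj u).length

theorem outLaw_apply [NeZero n] {p : unitInterval} (hp1 : p < 1) (l : List (Fin n)) :
    outLaw n p l = ENNReal.ofReal ((1 - p) * ((p : ℝ) / n) ^ l.length) := by
  have hsymm : unitInterval.symm p ≠ 0 := by
    intro h
    rw [unitInterval.symm_eq_zero] at h
    exact hp1.ne h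
  have hn : (0 : ℝ) < n := Nat.cast_pos.2 (NeZero.pos n)
  have hmap : ∀ k, ((PMF.uniformOfFintype (Fin k → Fin n)).map List.ofFn) l =
      if k = l.length then ENNReal.ofReal ((n : ℝ) ^ k)⁻¹ else 0 := by
    intro k
    rw [PMF.map_apply]
    split_ifs with hk
    · subst hk
      rw [tsum_eq_single l.get]
      · rw [if_pos (List.ofFn_get l).symm, PMF.uniformOfFintype_apply, Fintype.card_fun,
          Fintype.card_fin, Fintype.card_fin, ENNReal.ofReal_inv_of_pos (by positivity),
          ENNReal.ofReal_pow hn.le, ENNReal.ofReal_natCast]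
        simp
      · intro f hf
        rw [if_neg]
        intro h
        exact hf (List.ofFn_injective (h.symm.trans (List.ofFn_get l).symm))
    · refine ENNReal.tsum_eq_zero.2 fun f => if_neg fun h => hk ?_
      rw [h, List.length_ofFn]
  rw [outLaw, PMF.bind_apply, tsum_eq_single l.length]
  · rw [hmap, if_pos rfl, Measure.toPMF_apply, geometricMeasure_singleton hsymm,
      ← ENNReal.ofReal_mul (geometricMeasure_nonneg _ _)]
    congr 1
    have hpp : (1 : ℝ) - (1 - p) = p := sub_sub_cancel 1 (p : ℝ)
    rw [unitInterval.coe_symm_eq, hpp, div_pow]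
    ring
  · intro k hk
    rw [hmap, if_neg hk, mul_zero]

theorem digraphLaw_singleton [NeZero n] {p : unitInterval} (hp1 : p < 1)
    (adj : Fin n → List (Fin n)) :
    digraphLaw n p {adj} = ENNReal.ofReal ((1 - p) ^ n * ((p : ℝ) / n) ^ numArcs adj) := by
  have h1 : (0 : ℝ) ≤ 1 - p := sub_nonneg.2 p.2.2
  have h2 : (0 : ℝ) ≤ (p : ℝ) / n := div_nonneg p.2.1 n.cast_nonneg
  rw [digraphLaw, Measure.pi_singleton]
  simp_rw [PMF.toMeasure_apply_singleton _ _ (MeasurableSet.singleton _), outLaw_apply hp1]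
  rw [← ENNReal.ofReal_prod_of_nonneg fun i _ => by positivity]
  rw [Finset.prod_mul_distrib, Finset.prod_const, Finset.card_univ, Fintype.card_fin,
    Finset.prod_pow_eq_pow_sum]
  rfl

instance [NeZero n] (p : unitInterval) : IsProbabilityMeasure (digraphLaw n p) := by
  unfold digraphLaw; infer_instance

theorem tsum_pow_numArcs_ne_top [NeZero n] {q : ℝ} (hq0 : 0 ≤ q) (hq : q * n < 1) :
    ∑' adj : Fin n → List (Fin n), ENNReal.ofReal (q ^ numArcs adj) ≠ ∞ := by
  have hn : (0 : ℝ) < n := Nat.cast_pos.2 (NeZero.pos n)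
  -- the sum is the total mass for `p = q * n`, up to the normalizing factor `(1 - p) ^ n`
  let p : unitInterval := ⟨q * n, by positivity, hq.le⟩
  have hp1 : p < 1 := hq
  have htot := lintegral_countable' (μ := digraphLaw n p) fun _ => 1
  simp only [lintegral_one, measure_univ, one_mul, digraphLaw_singleton hp1] at htot
  have hpn : (p : ℝ) / n = q := by
    change q * n / n = q
    field_simp
  have h1 : (0 : ℝ) < 1 - p := sub_pos.2 hq
  simp_rw [hpn, ENNReal.ofReal_mul (pow_nonneg h1.le n)] at htot
  rw [ENNReal.tsum_mul_left] at htot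
  intro h
  rw [h, ENNReal.mul_top] at htot
  · exact one_ne_top htot
  · exact (ENNReal.ofReal_pos.2 (pow_pos h1 n)).ne'

theorem summable_pow_numArcs [NeZero n] {q : ℝ} (hq0 : 0 ≤ q) (hq : q * n < 1) :
    Summable fun adj : Fin n → List (Fin n) => q ^ numArcs adj := by
  have := ENNReal.summable_toReal (tsum_pow_numArcs_ne_top (n := n) hq0 hq)
  simpa only [ENNReal.toReal_ofReal (pow_nonneg hq0 _)] using this

end Law

/-! ### The generating function of one type of arcs -/

section Marked

open ENNReal

variable {n : ℕ}

/-- The generating function over all multidigraphs on `n` vertices in which each arc has weight `w`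
and each arc of type `κ` an additional factor `r`. -/
noncomputable def markedGF (n : ℕ) (κ : ArcKind) (w r : ℝ) : ℝ :=
  ∑' adj : Fin n → List (Fin n), w ^ numArcs adj * r ^ countKind κ (dfsArcs adj)

theorem summable_markedGF [NeZero n] (κ : ArcKind) {w r : ℝ} (hw0 : 0 ≤ w) (hw : w * n < 1)
    (hr0 : 0 ≤ r) (hr1 : r ≤ 1) :
    Summable fun adj : Fin n → List (Fin n) =>
      w ^ numArcs adj * r ^ countKind κ (dfsArcs adj) :=
  (summable_pow_numArcs hw0 hw).of_nonneg_of_le (fun _ => by positivity) fun _ =>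
    mul_le_of_le_one_right (by positivity) (pow_le_one₀ hr0 hr1)

/-- The weights of the arc types that mark the arcs of type `κ` by `r`. -/
def markWeight (κ : ArcKind) (w r : ℝ) (k : ArcKind) : ℝ := if k = κ then r * w else w

theorem arcsWeight_markWeight (κ : ArcKind) {w r : ℝ} (hw : 0 ≤ w) (hr : 0 ≤ r)
    (l : List (Fin n × Fin n × ArcKind)) :
    arcsWeight (fun k => ENNReal.ofReal (markWeight κ w r k)) l =
      ENNReal.ofReal (w ^ l.length * r ^ countKind κ l) := by
  unfold arcsWeight countKind
  induction l with
  | nil => simp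
  | cons e l ih =>
    rw [List.map_cons, List.prod_cons, ih, List.length_cons, List.countP_cons]
    dsimp only
    by_cases h : e.2.2 = κ
    · rw [markWeight, if_pos h, ← ENNReal.ofReal_mul (by positivity)]
      simp only [h, decide_true, if_true]
      congr 1; ring
    · rw [markWeight, if_neg h, ← ENNReal.ofReal_mul (by positivity)]
      simp only [h, decide_false, Bool.false_eq_true, if_false]
      congr 1; ring

theorem stepDenom_pos {w x y z q : ℝ} (hw : w ≤ q) (hx : x ≤ q) (hy : y ≤ q) (hz : z ≤ q)
    (hq0 : 0 ≤ q) (hq : q * n < 1) (k c d : ℕ) (hkc : k ≤ c) (hcd : c + d + 1 ≤ n) :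
    0 < stepDenom n w x y z k c d := by
  have h1 : (k : ℝ) ≤ c := Nat.cast_le.2 hkc
  have h2 : (c : ℝ) + d + 1 ≤ n := by exact_mod_cast hcd
  have h3 : (0 : ℝ) ≤ k := k.cast_nonneg
  have e1 : x * ((c : ℝ) - k) ≤ q * ((c : ℝ) - k) := mul_le_mul_of_nonneg_right hx (by linarith)
  have e2 : y * (d : ℝ) ≤ q * d := mul_le_mul_of_nonneg_right hy d.cast_nonneg
  have e3 : z * ((n : ℝ) - 1 - c - d) ≤ q * ((n : ℝ) - 1 - c - d) :=
    mul_le_mul_of_nonneg_right hz (by linarith)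
  have e4 : 0 ≤ q * k := mul_nonneg hq0 h3
  unfold stepDenom
  linarith

theorem markWeight_le (κ : ArcKind) {w r : ℝ} (hw : 0 ≤ w) (hr1 : r ≤ 1) (k : ArcKind) :
    markWeight κ w r k ≤ w := by
  unfold markWeight
  split_ifs
  · exact mul_le_of_le_one_left hw hr1
  · exact le_rfl

/-- The generating function of one type of arcs is a value of the generating function of
continuations, namely that of the search which has not yet started. -/
theorem markedGF_eq_stackGF [NeZero n] {κ : ArcKind} (hκ : κ ≠ .tree) {w r : ℝ} (hw0 : 0 < w)
    (hw : w * n < 1) (hr0 : 0 ≤ r) (hr1 : r ≤ 1) :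
    markedGF n κ w r = w ^ n * (n.factorial : ℝ) *
      stackGF n (markWeight κ w r .loop) (markWeight κ w r .forward) (markWeight κ w r .back)
        (markWeight κ w r .cross) w n [] := by
  have hle := markWeight_le κ hw0.le hr1
  have htree : markWeight κ w r .tree = w := if_neg hκ.symm
  have h0 : ∀ k, 0 ≤ markWeight κ w r k := fun k => by
    unfold markWeight; split_ifs <;> positivity
  have hfin : ∀ s : DFSState n, s.restSum (fun k => ENNReal.ofReal (markWeight κ w r k)) ≠ ∞ := by
    intro s
    refine ne_top_of_le_ne_top (tsum_pow_numArcs_ne_top (n := n) hw0.le hw)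
      ((s.restSum_le _ (q := ENNReal.ofReal w) fun k => ENNReal.ofReal_le_ofReal (hle k)).trans_eq
        (tsum_congr fun P => ?_))
    rw [ENNReal.ofReal_pow hw0.le]
    rfl
  let s₀ : DFSState n :=
    { seen := ∅, stack := [], pending := fun _ => [], treeArc := fun _ _ => False }
  have hs₀ : s₀.Tracks [] := ⟨List.nodup_nil, by simp [s₀], by simp [s₀], by simp [s₀], .nil⟩
  have hun : s₀.unseen = n := by simp [DFSState.unseen, s₀]
  have h := hs₀.restSum_eq (markWeight κ w r) h0 (by rw [htree]; exact hw0.ne') hfin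
    fun k c d hkc hcd =>
      (stepDenom_pos (hle _) (hle _) (hle _) (hle _) hw0.le hw k c d hkc hcd).ne'
  rw [hun, htree] at h
  rw [← h, DFSState.restSum, ENNReal.tsum_toReal_eq, markedGF]
  · refine tsum_congr fun adj => ?_
    have hlive : ∀ a, s₀.Live a := fun a => Or.inl (Finset.notMem_empty a)
    rw [if_pos fun a ha => absurd (hlive a) ha]
    change _ = (arcsWeight _ (dfsArcs adj)).toReal
    rw [arcsWeight_markWeight κ hw0.le hr0, length_dfsArcs,
      ENNReal.toReal_ofReal (by positivity)]
    rfl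
  · intro adj
    exact ENNReal.ne_top_of_tsum_ne_top (hfin s₀) adj

end Marked

/-! ### Knuth's conjecture in terms of numbers of multidigraphs -/

section Counting

variable {n : ℕ}

theorem finite_numArcs_eq (n a : ℕ) : {adj : Fin n → List (Fin n) | numArcs adj = a}.Finite := by
  refine (Set.Finite.pi' fun _ : Fin n => List.finite_length_le (Fin n) a).subset fun adj h u => ?_
  rw [Set.mem_ofPred_eq] at h
  rw [Set.mem_ofPred_eq, ← h]
  exact Finset.single_le_sum (f := fun u => (adj u).length) (fun _ _ => Nat.zero_le _)
    (Finset.mem_univ u)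

theorem countKind_le_numArcs (κ : ArcKind) (adj : Fin n → List (Fin n)) :
    countKind κ (dfsArcs adj) ≤ numArcs adj :=
  List.countP_le_length.trans_eq (length_dfsArcs adj)

/-- Among the multidigraphs on `n` vertices with a given number of arcs, forward arcs and back arcs
are equidistributed. -/
def EqualCounts (n : ℕ) : Prop :=
  ∀ a k, {adj : Fin n → List (Fin n) |
      numArcs adj = a ∧ countKind .forward (dfsArcs adj) = k}.ncard =
    {adj : Fin n → List (Fin n) | numArcs adj = a ∧ countKind .back (dfsArcs adj) = k}.ncard

theorem exists_equiv_of_ncard_fiber_eq {α β : Type*} (f g : α → β)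
    (hf : ∀ b, {a | f a = b}.Finite) (hg : ∀ b, {a | g a = b}.Finite)
    (h : ∀ b, {a | f a = b}.ncard = {a | g a = b}.ncard) :
    ∃ e : α ≃ α, ∀ a, g (e a) = f a := by
  have E : ∀ b, Nonempty ({a // f a = b} ≃ {a // g a = b}) := fun b => by
    have : Finite {a // f a = b} := (hf b).to_subtype
    have : Finite {a // g a = b} := (hg b).to_subtype
    exact Finite.card_eq.1 (h b)
  obtain ⟨E⟩ := Classical.nonempty_pi.2 E
  refine ⟨((Equiv.sigmaFiberEquiv f).symm.trans (Equiv.sigmaCongrRight E)).trans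
    (Equiv.sigmaFiberEquiv g), fun a => ?_⟩
  exact (E (f a) ⟨a, rfl⟩).2

/-- Equal counts amount to a permutation of the multidigraphs that preserves the number of arcs, and
hence the probability, and turns the number of forward arcs into the number of back arcs. -/
theorem EqualCounts.exists_equiv (h : EqualCounts n) :
    ∃ e : (Fin n → List (Fin n)) ≃ (Fin n → List (Fin n)), ∀ adj, numArcs (e adj) = numArcs adj ∧
      countKind .back (dfsArcs (e adj)) = countKind .forward (dfsArcs adj) := by
  have hfin : ∀ (κ : ArcKind) (b : ℕ × ℕ), {adj : Fin n → List (Fin n) |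
      (numArcs adj, countKind κ (dfsArcs adj)) = b}.Finite := fun κ b =>
    (finite_numArcs_eq n b.1).subset fun adj h => congrArg Prod.fst h
  obtain ⟨e, he⟩ := exists_equiv_of_ncard_fiber_eq
    (fun adj : Fin n → List (Fin n) => (numArcs adj, countKind .forward (dfsArcs adj)))
    (fun adj => (numArcs adj, countKind .back (dfsArcs adj))) (hfin _) (hfin _)
    (fun b => by
      rcases b with ⟨a, k⟩
      simpa only [Prod.mk.injEq] using h a k)
  exact ⟨e, fun adj => Prod.mk.injEq _ _ _ _ ▸ he adj⟩

theorem EqualCounts.identDistrib [NeZero n] (h : EqualCounts n) {p : unitInterval} (hp1 : p < 1) :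
    IdentDistrib (fun adj : Fin n → List (Fin n) => countKind .forward (dfsArcs adj))
      (fun adj : Fin n → List (Fin n) => countKind .back (dfsArcs adj))
      (digraphLaw n p) (digraphLaw n p) := by
  obtain ⟨e, he⟩ := h.exists_equiv
  have hmap : (digraphLaw n p).map e = digraphLaw n p := by
    refine Measure.ext_of_singleton fun adj => ?_
    rw [Measure.map_apply .of_discrete (.singleton adj)]
    have : e ⁻¹' {adj} = {e.symm adj} := by
      ext; simp [Equiv.eq_symm_apply]
    rw [this, digraphLaw_singleton hp1, digraphLaw_singleton hp1, ← (he (e.symm adj)).1,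
      e.apply_symm_apply]
  refine ⟨Measurable.of_discrete.aemeasurable, Measurable.of_discrete.aemeasurable, ?_⟩
  conv_rhs => rw [← hmap]
  rw [Measure.map_map .of_discrete .of_discrete]
  congr 1
  funext adj
  exact (he adj).2.symm

theorem markedGF_eq_of_identDistrib [NeZero n] {p : unitInterval} (hp1 : p < 1)
    (h : IdentDistrib (fun adj : Fin n → List (Fin n) => countKind .forward (dfsArcs adj))
      (fun adj : Fin n → List (Fin n) => countKind .back (dfsArcs adj))
      (digraphLaw n p) (digraphLaw n p)) {r : ℝ} (hr0 : 0 ≤ r) (hr1 : r ≤ 1) :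
    markedGF n .forward (p / n) r = markedGF n .back (p / n) r := by
  have h1 : (0 : ℝ) < 1 - p := sub_pos.2 hp1
  have hint : ∀ κ : ArcKind,
      ∫ adj : Fin n → List (Fin n), r ^ countKind κ (dfsArcs adj) ∂digraphLaw n p =
        (1 - p) ^ n * markedGF n κ (p / n) r := by
    intro κ
    have hi : Integrable (fun adj : Fin n → List (Fin n) => r ^ countKind κ (dfsArcs adj))
        (digraphLaw n p) := by
      refine Integrable.of_bound Measurable.of_discrete.aestronglyMeasurable 1 (ae_of_all _ ?_)
      intro adj
      rw [Real.norm_of_nonneg (pow_nonneg hr0 _)]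
      exact pow_le_one₀ hr0 hr1
    rw [integral_countable hi, markedGF, ← tsum_mul_left]
    refine tsum_congr fun adj => ?_
    have hp0 : (0 : ℝ) ≤ p := p.2.1
    rw [measureReal_def, digraphLaw_singleton hp1, ENNReal.toReal_ofReal (by positivity),
      smul_eq_mul, mul_assoc]
  have hcomp := (h.comp (u := fun k : ℕ => r ^ k) Measurable.of_discrete).integral_eq
  simp only [Function.comp_def] at hcomp
  rw [hint, hint] at hcomp
  exact mul_left_cancel₀ (pow_pos h1 n).ne' hcomp

theorem EqualCounts.markedGF_eq (h : EqualCounts n) (w r : ℝ) :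
    markedGF n .forward w r = markedGF n .back w r := by
  obtain ⟨e, he⟩ := h.exists_equiv
  rw [markedGF, markedGF,
    ← e.tsum_eq fun adj => w ^ numArcs adj * r ^ countKind .back (dfsArcs adj)]
  exact tsum_congr fun adj => by rw [(he adj).1, (he adj).2]

/-- A power series is determined by its values at points accumulating at `0`. -/
theorem eq_of_frequently_tsum_eq {a b : ℕ → ℝ} {ρ : ℝ} (hρ : 0 < ρ)
    (ha : Summable fun i => ρ ^ i * a i) (hb : Summable fun i => ρ ^ i * b i)
    (h : ∃ᶠ w in nhdsWithin 0 {0}ᶜ, ∑' i, w ^ i * a i = ∑' i, w ^ i * b i) : a = b := by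
  have hball : ∀ {a : ℕ → ℝ}, (Summable fun i => ρ ^ i * a i) →
      HasFPowerSeriesAt (fun w : ℝ => ∑' i, w ^ i * a i)
        (FormalMultilinearSeries.ofScalars ℝ a) 0 := by
    intro a ha
    have hrad : 0 < (FormalMultilinearSeries.ofScalars ℝ a).radius := by
      refine lt_of_lt_of_le (ENNReal.coe_pos.2 (Real.toNNReal_pos.2 hρ))
        (FormalMultilinearSeries.le_radius_of_tendsto (l := 0) _ ?_)
      have := ha.tendsto_atTop_zero.norm
      rw [norm_zero] at this
      refine this.congr fun i => ?_
      rw [FormalMultilinearSeries.ofScalars_norm, Real.coe_toNNReal _ hρ.le, norm_mul, norm_pow,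
        Real.norm_of_nonneg hρ.le, mul_comm]
    have := (FormalMultilinearSeries.hasFPowerSeriesOnBall _ hrad).hasFPowerSeriesAt
    refine this.congr (Filter.Eventually.of_forall fun w => ?_)
    change FormalMultilinearSeries.ofScalarsSum a w = _
    rw [FormalMultilinearSeries.ofScalars_sum_eq]
    exact tsum_congr fun i => by rw [smul_eq_mul, mul_comm]
  have hev := ((hball ha).analyticAt.frequently_eq_iff_eventually_eq (hball hb).analyticAt).1 h
  have heq := ((hball ha).congr hev).eq_formalMultilinearSeries (hball hb)
  funext i
  have := congrArg (fun q => FormalMultilinearSeries.coeff q i) heq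
  simpa using this

theorem hasSum_markedGF [NeZero n] (κ : ArcKind) {w r : ℝ} (hw0 : 0 ≤ w) (hw : w * n < 1)
    (hr0 : 0 ≤ r) (hr1 : r ≤ 1) :
    HasSum (fun a => w ^ a *
      ∑ adj ∈ (finite_numArcs_eq n a).toFinset, r ^ countKind κ (dfsArcs adj))
      (markedGF n κ w r) := by
  have h := (summable_markedGF κ hw0 hw hr0 hr1).hasSum.tsum_fiberwise (numArcs (n := n))
  suffices hfib : ∀ a, ∑' adj : (numArcs (n := n)) ⁻¹' {a},
      w ^ numArcs adj.1 * r ^ countKind κ (dfsArcs adj.1) =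
        w ^ a * ∑ adj ∈ (finite_numArcs_eq n a).toFinset, r ^ countKind κ (dfsArcs adj) by
    rw [markedGF]
    simp only [← hfib]
    exact h
  intro a
  have hset : (numArcs (n := n)) ⁻¹' {a} = ↑(finite_numArcs_eq n a).toFinset := by
    rw [Set.Finite.coe_toFinset]; rfl
  rw [hset, Finset.tsum_subtype' _ fun adj => w ^ numArcs adj * r ^ countKind κ (dfsArcs adj),
    Finset.mul_sum]
  refine Finset.sum_congr rfl fun adj h => ?_
  rw [show numArcs adj = a by simpa using h]

/-- The numbers of multidigraphs can be recovered from the values of the generating functions at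
a single transcendental `r`. -/
theorem equalCounts_of_frequently [NeZero n] {r : ℝ} (hr : Transcendental ℚ r) (hr0 : 0 ≤ r)
    (hr1 : r ≤ 1)
    (h : ∃ᶠ w : ℝ in nhdsWithin 0 {0}ᶜ, (0 < w ∧ w * n < 1) ∧
      markedGF n .forward w r = markedGF n .back w r) : EqualCounts n := by
  have hn : (0 : ℝ) < n := Nat.cast_pos.2 (NeZero.pos n)
  have hρ : (0 : ℝ) < 1 / (2 * n) := by positivity
  have hρ' : 1 / (2 * (n : ℝ)) * n < 1 := by field_simp; norm_num
  have hcoef := eq_of_frequently_tsum_eq hρ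
    (hasSum_markedGF (n := n) .forward hρ.le hρ' hr0 hr1).summable
    (hasSum_markedGF (n := n) .back hρ.le hρ' hr0 hr1).summable
    (h.mono fun w hw => by
      rw [(hasSum_markedGF _ hw.1.1.le hw.1.2 hr0 hr1).tsum_eq,
        (hasSum_markedGF _ hw.1.1.le hw.1.2 hr0 hr1).tsum_eq, hw.2])
  intro a k
  set A := (finite_numArcs_eq n a).toFinset with hA
  let P : ArcKind → Polynomial ℚ := fun κ => ∑ adj ∈ A, Polynomial.X ^ countKind κ (dfsArcs adj)
  have hP : P .forward = P .back := by
    refine transcendental_iff_injective.1 hr ?_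
    simpa [P] using congrFun hcoef a
  have hcard : ∀ κ : ArcKind, (P κ).coeff k =
      ({adj : Fin n → List (Fin n) | numArcs adj = a ∧
        countKind κ (dfsArcs adj) = k}.ncard : ℚ) := by
    intro κ
    have hset : {adj : Fin n → List (Fin n) | numArcs adj = a ∧ countKind κ (dfsArcs adj) = k} =
        ↑(A.filter fun adj => k = countKind κ (dfsArcs adj)) := by
      ext adj; simp [hA, eq_comm]
    rw [hset, Set.ncard_coe_finset, Polynomial.finsetSum_coeff]
    simp_rw [Polynomial.coeff_X_pow]
    rw [Finset.sum_boole]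
  have := congrArg (fun Q => Q.coeff k) hP
  simp only [hcard] at this
  exact_mod_cast this

end Counting

/-! ### The specialized generating functions of instances -/

section Specialization

variable {n : ℕ}

/-- The numbers of arcs of the five types, in the order of the variables of `dfsGF`. -/
noncomputable def profile (l : List (Fin n × Fin n × ArcKind)) : Fin 5 →₀ ℕ :=
  Finsupp.equivFunOnFinite.symm ![countKind .loop l, countKind .forward l, countKind .back l,
    countKind .cross l, countKind .tree l]

theorem coeff_dfsGF (d : Fin 5 →₀ ℕ) :
    MvPowerSeries.coeff d (dfsGF n) = ({l ∈ dfsInstances n | profile l = d}.ncard : ℚ) := by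
  have : ∀ l : List (Fin n × Fin n × ArcKind), profile l = d ↔
      countKind .loop l = d 0 ∧ countKind .forward l = d 1 ∧ countKind .back l = d 2 ∧
        countKind .cross l = d 3 ∧ countKind .tree l = d 4 := fun l => by
    simp [Finsupp.ext_iff, Fin.forall_fin_succ, profile]
  simp_rw [this]
  rfl

theorem sum_countKind (l : List (Fin n × Fin n × ArcKind)) :
    countKind .loop l + countKind .forward l + countKind .back l + countKind .cross l +
      countKind .tree l = l.length := by
  unfold countKind
  induction l with
  | nil => rfl
  | cons e l ih =>
    simp only [List.countP_cons, List.length_cons, ← ih]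
    rcases h : e.2.2 <;> simp <;> omega

/-- Counting the elements of `s` over `c` by their images under `π`. -/
theorem finsum_ncard_fiber {α β γ : Type*} (s : Set α) (π : α → β) (φ : β → γ) (c : γ)
    [DecidableEq γ] (hfin : {a ∈ s | φ (π a) = c}.Finite) :
    ∑ᶠ b, ({a ∈ s | π a = b}.ncard : ℚ) * (if c = φ b then 1 else 0) =
      ({a ∈ s | φ (π a) = c}.ncard : ℚ) := by
  classical
  set T := hfin.toFinset with hT
  have hmem : ∀ a, a ∈ T ↔ a ∈ s ∧ φ (π a) = c := fun a => by simp [hT]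
  have hfib : ∀ b, c = φ b → {a ∈ s | π a = b} = ↑(T.filter fun a => π a = b) := by
    rintro b rfl
    ext a
    simp only [Set.mem_ofPred_eq, Finset.coe_filter, hmem]
    exact ⟨fun h => ⟨⟨h.1, congrArg φ h.2⟩, h.2⟩, fun h => ⟨h.1.1, h.2⟩⟩
  rw [finsum_eq_sum_of_support_subset (s := T.image π), Set.ncard_eq_toFinset_card _ hfin, ← hT,
    Finset.card_eq_sum_card_image π T]
  · push_cast
    refine Finset.sum_congr rfl fun b hb => ?_
    obtain ⟨a, ha, rfl⟩ := Finset.mem_image.1 hb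
    have hc := ((hmem a).1 ha).2.symm
    rw [if_pos hc, mul_one, hfib _ hc, Set.ncard_coe_finset]
  · intro b hb
    by_cases hc : c = φ b
    · rw [Function.mem_support, hfib b hc, Set.ncard_coe_finset, if_pos hc, mul_one] at hb
      obtain ⟨a, ha⟩ := Finset.card_ne_zero.1 (Nat.cast_ne_zero.1 hb)
      rw [Finset.mem_filter] at ha
      exact Finset.mem_coe.2 (Finset.mem_image.2 ⟨a, ha.1, ha.2⟩)
    · simp [hc] at hb

theorem coeff_subst_dfsGF (v : Fin 5 → Fin 2) (e : Fin 2 →₀ ℕ)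
    (hfin : {l ∈ dfsInstances n | Finsupp.mapDomain v (profile l) = e}.Finite) :
    MvPowerSeries.coeff e (MvPowerSeries.subst (fun i => serVar (v i)) (dfsGF n)) =
      ({l ∈ dfsInstances n | Finsupp.mapDomain v (profile l) = e}.ncard : ℚ) := by
  classical
  have hsub : MvPowerSeries.HasSubst fun i => serVar (v i) :=
    MvPowerSeries.hasSubst_of_constantCoeff_zero fun i => MvPowerSeries.constantCoeff_X _
  rw [MvPowerSeries.coeff_subst hsub, ← finsum_ncard_fiber _ _ _ _ hfin]
  refine finsum_congr fun d => ?_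
  rw [coeff_dfsGF, smul_eq_mul]
  congr 1
  have : (d.prod fun i k => serVar (v i) ^ k) =
      MvPowerSeries.monomial (R := ℚ) (d.mapDomain v) 1 :=
    (MvPowerSeries.monomial_mapDomain_apply_one d v).symm
  rw [this, MvPowerSeries.coeff_monomial]

theorem ncard_dfsInstances (Q : List (Fin n × Fin n × ArcKind) → Prop) :
    {l ∈ dfsInstances n | Q l}.ncard = {adj : Fin n → List (Fin n) | Q (dfsArcs adj)}.ncard := by
  rw [← Set.ncard_image_of_injective _ dfsArcs_injective]
  congr 1
  ext l
  constructor
  · rintro ⟨⟨adj, rfl⟩, h⟩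
    exact ⟨adj, h, rfl⟩
  · rintro ⟨adj, h, rfl⟩
    exact ⟨⟨adj, rfl⟩, h⟩

theorem finite_dfsInstances {Q : List (Fin n × Fin n × ArcKind) → Prop} {a : ℕ}
    (hQ : ∀ l, Q l → l.length = a) : {l ∈ dfsInstances n | Q l}.Finite := by
  refine ((finite_numArcs_eq n a).image dfsArcs).subset ?_
  rintro _ ⟨⟨adj, rfl⟩, h⟩
  exact ⟨adj, (length_dfsArcs adj).symm.trans (hQ _ h), rfl⟩

/-- Replacing the variable of the arcs of type `κ` by `x` and all other variables by `w`. -/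
theorem coeff_subst_marked {κ : ArcKind} {v : Fin 5 → Fin 2}
    (hv : ∀ l : List (Fin n × Fin n × ArcKind), Finsupp.mapDomain v (profile l) 0 +
        Finsupp.mapDomain v (profile l) 1 = l.length ∧
      Finsupp.mapDomain v (profile l) 1 = countKind κ l) (e : Fin 2 →₀ ℕ) :
    MvPowerSeries.coeff e (MvPowerSeries.subst (fun i => serVar (v i)) (dfsGF n)) =
      ({adj : Fin n → List (Fin n) |
        numArcs adj = e 0 + e 1 ∧ countKind κ (dfsArcs adj) = e 1}.ncard : ℚ) := by
  have hiff : ∀ l : List (Fin n × Fin n × ArcKind), Finsupp.mapDomain v (profile l) = e ↔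
      l.length = e 0 + e 1 ∧ countKind κ l = e 1 := fun l => by
    have := hv l
    rw [Finsupp.ext_iff, Fin.forall_fin_two]
    omega
  rw [coeff_subst_dfsGF v e (finite_dfsInstances fun l h => ((hiff l).1 h).1)]
  simp_rw [hiff]
  rw [ncard_dfsInstances]
  simp_rw [length_dfsArcs]
  rfl

theorem subst_dfsGF_eq_iff (n : ℕ) :
    MvPowerSeries.subst ![serVar 0, serVar 1, serVar 0, serVar 0, serVar 0] (dfsGF n) =
      MvPowerSeries.subst ![serVar 0, serVar 0, serVar 1, serVar 0, serVar 0] (dfsGF n) ↔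
    EqualCounts n := by
  have h1 : (![serVar 0, serVar 1, serVar 0, serVar 0, serVar 0] :
      Fin 5 → MvPowerSeries (Fin 2) ℚ) = fun i =>
        serVar ((![0, 1, 0, 0, 0] : Fin 5 → Fin 2) i) := by
    funext i; fin_cases i <;> rfl
  have h2 : (![serVar 0, serVar 0, serVar 1, serVar 0, serVar 0] :
      Fin 5 → MvPowerSeries (Fin 2) ℚ) = fun i =>
        serVar ((![0, 0, 1, 0, 0] : Fin 5 → Fin 2) i) := by
    funext i; fin_cases i <;> rfl
  have hF := coeff_subst_marked (n := n) (κ := .forward) (v := ![0, 1, 0, 0, 0]) fun l => by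
    rw [← sum_countKind l]
    simp [Finsupp.mapDomain, Finsupp.sum_fintype, Fin.sum_univ_five, profile]
    omega
  have hB := coeff_subst_marked (n := n) (κ := .back) (v := ![0, 0, 1, 0, 0]) fun l => by
    rw [← sum_countKind l]
    simp [Finsupp.mapDomain, Finsupp.sum_fintype, Fin.sum_univ_five, profile]
    omega
  rw [h1, h2, MvPowerSeries.ext_iff]
  simp_rw [hF, hB, Nat.cast_inj]
  constructor
  · intro h a k
    by_cases hk : k ≤ a
    · simpa [Nat.sub_add_cancel hk] using
        h (Finsupp.equivFunOnFinite.symm ![a - k, k])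
    · have hempty : ∀ κ : ArcKind, {adj : Fin n → List (Fin n) |
          numArcs adj = a ∧ countKind κ (dfsArcs adj) = k} = ∅ := fun κ => by
        ext adj
        have := countKind_le_numArcs κ adj
        simp only [Set.mem_ofPred_eq, Set.mem_empty_iff_false, iff_false]
        omega
      rw [hempty, hempty]
  · intro h e
    exact h _ _

end Specialization

/-! ### Evaluation of rational functions at generic real numbers -/

section Generic

theorem exists_transcendental_mem_Ioo {a b : ℝ} (hab : a < b) :
    ∃ r ∈ Set.Ioo a b, Transcendental ℚ r := by
  have hd := (Algebraic.countable ℚ ℝ).dense_compl ℝ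
  obtain ⟨r, hr, hr'⟩ := hd.exists_mem_open isOpen_Ioo (Set.nonempty_Ioo.2 hab)
  exact ⟨r, hr', hr⟩

theorem countable_adjoin_singleton (r : ℝ) : Countable (Algebra.adjoin ℚ {r}) := by
  have hc : Countable (Polynomial ℚ) := by
    rw [← Cardinal.mk_le_aleph0_iff]
    exact Polynomial.cardinalMk_le_max.trans (by simp)
  rw [Algebra.adjoin_singleton_eq_range_aeval]
  exact (Set.countable_range (Polynomial.aeval (R := ℚ) r)).to_subtype

theorem frequently_transcendental (r : ℝ) {ε : ℝ} (hε : 0 < ε) :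
    ∃ᶠ w : ℝ in nhdsWithin 0 {0}ᶜ, (0 < w ∧ w < ε) ∧
      Transcendental (Algebra.adjoin ℚ {r}) w := by
  have := countable_adjoin_singleton r
  have hd := (Algebraic.countable (Algebra.adjoin ℚ {r}) ℝ).dense_compl ℝ
  rw [(nhdsWithin_hasBasis Metric.nhds_basis_ball ({0}ᶜ : Set ℝ)).frequently_iff]
  intro δ hδ
  obtain ⟨w, hw, hw'⟩ := hd.exists_mem_open isOpen_Ioo
    (Set.nonempty_Ioo.2 (lt_min hε hδ : (0 : ℝ) < min ε δ))
  refine ⟨w, ⟨?_, hw'.1.ne'⟩, ⟨hw'.1, hw'.2.trans_le (min_le_left _ _)⟩, hw⟩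
  rw [Metric.mem_ball, dist_zero_right, Real.norm_of_nonneg hw'.1.le]
  exact hw'.2.trans_le (min_le_right _ _)

/-- If `r` is transcendental and `w` is transcendental over `ℚ[r]`, then `w` and `r * w` are
algebraically independent. -/
theorem aeval_pair_injective {r w : ℝ} (hr : Transcendental ℚ r)
    (hw : Transcendental (Algebra.adjoin ℚ {r}) w) :
    Function.Injective (MvPolynomial.aeval (R := ℚ) ![w, r * w]) := by
  rw [injective_iff_map_eq_zero]
  intro P hP
  let r' : Algebra.adjoin ℚ {r} := ⟨r, Algebra.self_mem_adjoin_singleton ℚ r⟩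
  -- as a polynomial in `w`, `P(w, r * w)` has the polynomials in `r` that collect the terms of `P`
  -- of a fixed total degree as coefficients
  let Q : Polynomial (Algebra.adjoin ℚ {r}) :=
    ∑ d ∈ P.support, Polynomial.monomial (d 0 + d 1) (algebraMap ℚ _ (P.coeff d) * r' ^ d 1)
  have hQ : Q = 0 := by
    refine transcendental_iff.1 hw Q ?_
    rw [← hP, MvPolynomial.aeval_def, MvPolynomial.eval₂_eq', map_sum]
    refine Finset.sum_congr rfl fun d _ => ?_
    rw [Polynomial.aeval_monomial, Fin.prod_univ_two]
    have : algebraMap (Algebra.adjoin ℚ {r}) ℝ (algebraMap ℚ _ (P.coeff d) * r' ^ d 1) =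
        algebraMap ℚ ℝ (P.coeff d) * r ^ d 1 := by
      rw [map_mul, map_pow]
      rfl
    rw [this]
    simp only [Matrix.cons_val_zero, Matrix.cons_val_one]
    ring
  ext d
  by_contra hd
  rw [MvPolynomial.coeff_zero] at hd
  let p : Polynomial ℚ :=
    ∑ d' ∈ P.support, if d' 0 + d' 1 = d 0 + d 1 then Polynomial.monomial (d' 1) (P.coeff d') else 0
  have hp : p = 0 := by
    refine transcendental_iff.1 hr p ?_
    have hcoef := congrArg (fun q => algebraMap (Algebra.adjoin ℚ {r}) ℝ (q.coeff (d 0 + d 1))) hQ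
    simp only [Q, Polynomial.finsetSum_coeff, Polynomial.coeff_monomial, map_sum,
      Polynomial.coeff_zero, map_zero] at hcoef
    rw [← hcoef, map_sum]
    refine Finset.sum_congr rfl fun d' _ => ?_
    split_ifs
    · rw [Polynomial.aeval_monomial, map_mul, map_pow]
      rfl
    · simp
  have hcoef := congrArg (fun q => q.coeff (d 1)) hp
  simp only [p, Polynomial.finsetSum_coeff, Polynomial.coeff_zero] at hcoef
  rw [Finset.sum_eq_single d] at hcoef
  · rw [if_pos rfl, Polynomial.coeff_monomial, if_pos rfl] at hcoef
    exact hd hcoef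
  · intro d' _ hd'
    split_ifs with h
    · rw [Polynomial.coeff_monomial, if_neg]
      intro h1
      refine hd' (Finsupp.ext (Fin.forall_fin_two.2 ⟨by omega, h1⟩))
    · simp
  · intro h
    exact absurd (MvPolynomial.mem_support_iff.2 hd) h

theorem map_treeGF {K L : Type*} [Field K] [Field L] (f : K →+* L) (x y z : K) (j : ℕ) (w : K) :
    f (treeGF x y z j w) = treeGF (f x) (f y) (f z) j (f w) := by
  induction j using Nat.strong_induction_on generalizing w with
  | _ j ih =>
    rw [treeGF_eq, treeGF_eq (f x), map_div₀, map_add, map_sum]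
    congr 1
    · congr 1
      · split_ifs <;> simp
      · refine Finset.sum_congr rfl fun i hi => ?_
        have hi := Finset.mem_range.1 hi
        rw [map_mul, ih i hi, ih (j - 1 - i) (by omega)]
        simp
    · simp

/-- The rational functions `Ĝ^X` and `Ĝ^Y` of index `j + 1` agree for `z = w`. -/
def TreeEq (j : ℕ) : Prop :=
  GX (j + 1) (ratVar 0) (ratVar 1) (ratVar 0) = GY (j + 1) (ratVar 0) (ratVar 1) (ratVar 0)

theorem treeEq_iff {r w : ℝ} (hr : Transcendental ℚ r)
    (hw : Transcendental (Algebra.adjoin ℚ {r}) w) (j : ℕ) :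
    TreeEq j ↔ treeGF (r * w) w w j w = treeGF w (r * w) w j w := by
  have hinj : Function.Injective (MvPolynomial.aeval (R := ℚ) ![w, r * w]).toRingHom :=
    aeval_pair_injective hr hw
  let f : RatFunc2 →+* ℝ := IsFractionRing.lift hinj
  have h0 : f (ratVar 0) = w := by
    refine (IsFractionRing.lift_algebraMap hinj _).trans ?_
    simp
  have h1 : f (ratVar 1) = r * w := by
    refine (IsFractionRing.lift_algebraMap hinj _).trans ?_
    simp
  rw [TreeEq, GX_eq_treeGF, GY_eq_treeGF, ← f.injective.eq_iff, map_treeGF, map_treeGF, h0, h1]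

/-- By homogeneity, the identity of the rational functions allows the first argument to be shifted
by a multiple of `w`. -/
theorem TreeEq.shift {j : ℕ} (h : TreeEq j) {r w : ℝ} (hr : Transcendental ℚ r)
    (hw : Transcendental (Algebra.adjoin ℚ {r}) w) (N : ℤ) :
    treeGF (r * w) w w j (w + w * N) = treeGF w (r * w) w j (w + w * N) := by
  set l : ℝ := 1 - N * w with hl
  have hl0 : l ≠ 0 := by
    intro h0
    refine hw ?_
    have hN : (N : ℝ) ≠ 0 := by
      intro hN
      rw [hl, hN] at h0
      norm_num at h0
    have : w = (N : ℝ)⁻¹ := by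
      field_simp
      linarith
    rw [this]
    exact (isAlgebraic_intCast N).inv
  have hw' : Transcendental (Algebra.adjoin ℚ {r}) (w / l) := by
    intro halg
    -- `w` is a fractional linear function of `w / l`
    have hden : 1 + N * (w / l) = l⁻¹ := by
      field_simp
      rw [hl]
      ring
    have : w = (w / l) * (1 + N * (w / l))⁻¹ := by
      rw [hden, inv_inv, div_mul_cancel₀ _ hl0]
    refine hw ?_
    rw [this]
    exact halg.mul (isAlgebraic_one.add ((isAlgebraic_intCast N).mul halg)).inv
  have hX := treeGF_scale l (r * (w / l)) (w / l) (w / l) j (w / l)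
  have hY := treeGF_scale l (w / l) (r * (w / l)) (w / l) j (w / l)
  rw [(treeEq_iff hr hw' j).1 h, ← hY] at hX
  have e1 : l * (w / l) = w := mul_div_cancel₀ _ hl0
  have e2 : l * (r * (w / l)) = r * w := by rw [mul_left_comm, e1]
  have e3 : 1 - l * (1 - w / l) = w + w * N := by
    rw [mul_sub, e1, hl]; ring
  rwa [e1, e2, e3] at hX

/-- If the tree generating functions agree, so do the generating functions of the searches that
still have to reach `k` of the `n` vertices from new roots. -/
theorem stackGF_nil_congr {r w : ℝ} (hr : Transcendental ℚ r)
    (hw : Transcendental (Algebra.adjoin ℚ {r}) w) (hr1 : r ≤ 1) (hw0 : 0 < w)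
    {n : ℕ} (hwn : w * n < 1) (k : ℕ) (hk : k ≤ n) (h : ∀ j < k, TreeEq j) :
    stackGF n w (r * w) w w w k [] = stackGF n w w (r * w) w w k [] := by
  have hx : r * w ≤ w := mul_le_of_le_one_left hw0.le hr1
  induction k using Nat.strong_induction_on with
  | _ k ih =>
    rcases k with _ | k
    · simp only [stackGF]
    · rw [stackGF_nil_succ n _ _ _ _ _ (fun k c d hkc hcd =>
          (stepDenom_pos le_rfl hx le_rfl le_rfl hw0.le hwn k c d hkc hcd).ne') k hk,
        stackGF_nil_succ n _ _ _ _ _ (fun k c d hkc hcd =>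
          (stepDenom_pos le_rfl le_rfl hx le_rfl hw0.le hwn k c d hkc hcd).ne') k hk]
      congr 1
      refine Finset.sum_congr rfl fun m hm => ?_
      have hm := Finset.mem_range.1 hm
      have hsh := (h m hm).shift hr hw ((n : ℤ) - 1 - k)
      push_cast at hsh
      rw [hsh, ih (k - m) (by omega) (by omega) fun j hj => h j (by omega)]

theorem markedGF_eq_iff {r w : ℝ} (hr0 : 0 ≤ r) (hr1 : r ≤ 1) (hw0 : 0 < w) {n : ℕ} [NeZero n]
    (hwn : w * n < 1) :
    markedGF n .forward w r = markedGF n .back w r ↔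
      stackGF n w (r * w) w w w n [] = stackGF n w w (r * w) w w n [] := by
  have hn : w ^ n * (n.factorial : ℝ) ≠ 0 :=
    mul_ne_zero (pow_ne_zero _ hw0.ne') (Nat.cast_ne_zero.2 n.factorial_ne_zero)
  rw [markedGF_eq_stackGF (by decide) hw0 hwn hr0 hr1,
    markedGF_eq_stackGF (by decide) hw0 hwn hr0 hr1, mul_right_inj' hn]
  simp [markWeight]

theorem forall_equalCounts_iff :
    (∀ n, 1 ≤ n → EqualCounts n) ↔ ∀ j, TreeEq j := by
  obtain ⟨r, ⟨hr0, hr1⟩, hr⟩ := exists_transcendental_mem_Ioo (zero_lt_one' ℝ)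
  have hfreq : ∀ n : ℕ, 1 ≤ n → ∃ᶠ w : ℝ in nhdsWithin 0 {0}ᶜ, (0 < w ∧ w * n < 1) ∧
      Transcendental (Algebra.adjoin ℚ {r}) w := fun n hn => by
    have hn' : (0 : ℝ) < n := Nat.cast_pos.2 hn
    refine (frequently_transcendental r (one_div_pos.2 hn')).mono fun w hw =>
      ⟨⟨hw.1.1, (lt_div_iff₀ hn').1 hw.1.2⟩, hw.2⟩
  constructor
  · intro h j
    induction j using Nat.strong_induction_on with
    | _ j ih =>
      obtain ⟨w, ⟨hw0, hwn⟩, hw⟩ := (hfreq (j + 1) (by omega)).exists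
      have heq := (markedGF_eq_iff hr0.le hr1.le hw0 hwn).1 ((h (j + 1) (by omega)).markedGF_eq w r)
      have hx : r * w ≤ w := mul_le_of_le_one_left hw0.le hr1.le
      rw [stackGF_nil_succ _ _ _ _ _ _ (fun k c d hkc hcd =>
          (stepDenom_pos le_rfl hx le_rfl le_rfl hw0.le hwn k c d hkc hcd).ne') j le_rfl,
        stackGF_nil_succ _ _ _ _ _ _ (fun k c d hkc hcd =>
          (stepDenom_pos le_rfl le_rfl hx le_rfl hw0.le hwn k c d hkc hcd).ne') j le_rfl,
        div_left_inj' (mul_ne_zero hw0.ne' (by positivity)), Finset.sum_range_succ,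
        Finset.sum_range_succ] at heq
      have hz : w + w * (((j + 1 : ℕ) : ℝ) - 1 - j) = w := by push_cast; ring
      simp only [hz, Nat.sub_self, stackGF, mul_one] at heq
      -- all terms but the one of the largest tree agree by the induction hypothesis
      have hsum : ∑ m ∈ Finset.range j, treeGF (r * w) w w m w *
          stackGF (j + 1) w (r * w) w w w (j - m) [] =
          ∑ m ∈ Finset.range j, treeGF w (r * w) w m w *
            stackGF (j + 1) w w (r * w) w w (j - m) [] := by
        refine Finset.sum_congr rfl fun m hm => ?_
        have hm := Finset.mem_range.1 hm
        rw [(treeEq_iff hr hw m).1 (ih m hm),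
          stackGF_nil_congr hr hw hr1.le hw0 hwn (j - m) (by omega)
            fun i hi => ih i (by omega)]
      rw [hsum] at heq
      exact (treeEq_iff hr hw j).2 (add_left_cancel heq)
  · intro h n hn
    have : NeZero n := ⟨by omega⟩
    refine equalCounts_of_frequently hr hr0.le hr1.le ((hfreq n hn).mono fun w hw => ⟨hw.1, ?_⟩)
    exact (markedGF_eq_iff hr0.le hr1.le hw.1.1 hw.1.2).2
      (stackGF_nil_congr hr hw.2 hr1.le hw.1.1 hw.1.2 n le_rfl fun j _ => h j)

theorem knuthConjecture_iff : KnuthConjecture ↔ ∀ n, 1 ≤ n → EqualCounts n := by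
  constructor
  · intro h n hn
    have : NeZero n := ⟨by omega⟩
    have hn' : (0 : ℝ) < n := Nat.cast_pos.2 hn
    obtain ⟨r, ⟨hr0, hr1⟩, hr⟩ := exists_transcendental_mem_Ioo (zero_lt_one' ℝ)
    refine equalCounts_of_frequently hr hr0.le hr1.le
      ((frequently_transcendental r (one_div_pos.2 hn')).mono fun w hw => ?_)
    have hwn := (lt_div_iff₀ hn').1 hw.1.2
    let p : unitInterval := ⟨w * n, mul_nonneg hw.1.1.le hn'.le, hwn.le⟩
    have hp0 : 0 < p := mul_pos hw.1.1 hn'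
    have hp1 : p < 1 := hwn
    have := markedGF_eq_of_identDistrib hp1 (h n p hp0 hp1) hr0.le hr1.le
    rw [show (p : ℝ) / n = w from mul_div_cancel_right₀ w hn'.ne'] at this
    exact ⟨⟨hw.1.1, hwn⟩, this⟩
  · intro h n _ p _ hp1
    exact (h n (NeZero.pos n)).identDistrib hp1

end Generic

theorem mainTheorem1 :
    (KnuthConjecture ↔
      ∀ n : ℕ, 1 ≤ n →
        MvPowerSeries.subst ![serVar 0, serVar 1, serVar 0, serVar 0, serVar 0] (dfsGF n) =
          MvPowerSeries.subst ![serVar 0, serVar 0, serVar 1, serVar 0, serVar 0] (dfsGF n)) ∧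
    (KnuthConjecture ↔
      ∀ n : ℕ, 1 ≤ n →
        GX n (ratVar 0) (ratVar 1) (ratVar 0) = GY n (ratVar 0) (ratVar 1) (ratVar 0)) := by
  refine ⟨?_, ?_⟩
  · rw [knuthConjecture_iff]
    simp_rw [subst_dfsGF_eq_iff]
  · rw [knuthConjecture_iff, forall_equalCounts_iff]
    refine ⟨fun h n hn => ?_, fun h j => h (j + 1) (by omega)⟩
    obtain ⟨j, rfl⟩ := Nat.exists_eq_add_of_le' hn
    exact h j
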